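/- **Classical reversible circuit for QBall$_1$.** Let $0\le r\le n$ be integers and let $F=(C_1,\dots,C_L)$ be a 3-SAT formula over variables $x_1,\dots,x_n$, i.e. an ordered list of clauses with at most three literals each. *The set $V(\vec s)$.* For a set $V$ of positive integers let $x(V)$ be the assignment that sets $x_a$ to $1$ if $a\in V$ and to $0$ otherwise. For $\vec s=(s_1,\dots,s_r)\in\{1,2,3\}^r$ put $V_0=\emptyset$, and for $i=1,\dots,r$ put $V_i=V_{i-1}\cup\{v_i\}$, where $v_i$ is the $s_i$-th smallest index, not in $V_{i-1}$, of a variable of the first clause of $F$ that is not satisfied by $x(V_{i-1})$; if there is no such clause or no such index, $v_i=n+i$ (a dummy variable). Let $V(\vec s)=V_r=\{v_1,\dots,v_r\}$. *The encoding.* For a set $S=\{y_1<\dots<y_k\}$ of positive integers, $|\mathrm{enc}\,S\rangle$ is a register of $\lceil k\log_2(n/k)\rceil+4k$ trits that contains the numbers $y_1,\,y_2-y_1,\dots,y_k-y_{k-1}$ in binary without leading zeros, each followed by a separation character (the third symbol of the trit), and then zeros. If $r=2^{e_1}+\dots+2^{e_m}$ with $e_1>\dots>e_m$, cut $v_1,\dots,v_r$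 into consecutive blocks $B_1,\dots,B_m$ with $|B_j|=2^{e_j}$, and let $|\mathrm{EffEnc}\,V(\vec s)\rangle=|\mathrm{enc}\,B_1\rangle\cdots|\mathrm{enc}\,B_m\rangle$. Every trit, also of $\vec s$, is stored in two bits, the symbol $0$ as $00$. *Reversible implementation.* A bijection $f$ of $\{0,1\}^q$ can be implemented reversibly using $l$ ancillas and $g$ gates if some circuit of at most $g$ gates, each a NOT, CNOT or Toffoli gate, maps $|x\rangle|0\rangle^{\otimes l}$ to $|f(x)\rangle|0\rangle^{\otimes l}$ for all $x\in\{0,1\}^q$. **Claim.** The map $|\vec s\rangle|0\rangle\mapsto|\vec s\rangle|\mathrm{EffEnc}\,V(\vec s)\rangle$ can be implemented reversibly using $O(r\log(n/r)+r+\log n)$ ancillas and $O(\mathrm{poly}(n))$ gates, and the $\mathrm{EffEnc}$ register itself has $O(r\log(n/r)+r)$ bits. That is, there are constants $K,A,d$, independent of $n$, $r$ and $F$ (and of the number $L$ of clauses), such that for all $r\le n$ and all $F$ the $\mathrm{EffEnc}$ register has at most $K(r\log_2(n/r)+r)$ bits, and there is a bijection $f$ of the bit strings of the two registers with $f(\vec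 s,0)=(\vec s,\mathrm{EffEnc}\,V(\vec s))$ for all $\vec s\in\{1,2,3\}^r$ that can be implemented reversibly using at most $K(r\log_2(n/r)+r+\log_2 n)$ ancillas and at most $A\,n^d$ gates. (Here $r\log_2(n/r)=0$ for $r=0$, and $\log_2 n$ is read as $0$ for $n=0$.) -/

import Mathlib

namespace QBall

/-! ### Reversible circuits -/

/-- Elementary gates of a classical reversible circuit on `m` bits: NOT, CNOT, Toffoli.  In each
case the last wire `t` is the target and it differs from the control wires. -/
inductive Gate (m : ℕ) where
  | not (t : Fin m)
  | cnot (c t : Fin m) (h : c ≠ t)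
  | toffoli (c₁ c₂ t : Fin m) (h₁₂ : c₁ ≠ c₂) (h₁ : c₁ ≠ t) (h₂ : c₂ ≠ t)

/-- The action of a gate on bit strings. -/
def Gate.apply {m : ℕ} : Gate m → (Fin m → Bool) → (Fin m → Bool)
  | .not t, x => Function.update x t (!x t)
  | .cnot c t _, x => Function.update x t (xor (x t) (x c))
  | .toffoli c₁ c₂ t _ _ _, x => Function.update x t (xor (x t) (x c₁ && x c₂))

/-- A circuit is a sequence of gates, run from left to right; its size is its length. -/
abbrev Circuit (m : ℕ) := List (Gate m)

/-- The map computed by a circuit. -/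
def Circuit.run {m : ℕ} (c : Circuit m) (x : Fin m → Bool) : Fin m → Bool :=
  c.foldl (fun y g => g.apply y) x

/-- The all-zero register of `m` bits. -/
def zeros (m : ℕ) : Fin m → Bool := fun _ => false

/-- The bijection `f` of `{0,1}^q` can be implemented reversibly using `l` ancillas and `g` gates:
some circuit with at most `g` elementary gates maps `|x⟩|0^l⟩` to `|f x⟩|0^l⟩` for every `x`. -/
def ImplementableReversibly {q : ℕ} (f : Equiv.Perm (Fin q → Bool)) (l g : ℕ) : Prop :=
  ∃ c : Circuit (q + l), c.length ≤ g ∧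
    ∀ x : Fin q → Bool, c.run (Fin.append x (zeros l)) = Fin.append (f x) (zeros l)

/-! ### Formulas and the non-recursive form of the ball search -/

/-- A clause with at most three literals over the variables `x_1, …, x_n`.  The variable `x_a` is
represented by `a - 1 : Fin n`; the literal `(x, true)` is `x` and `(x, false)` is its negation. -/
structure Clause (n : ℕ) where
  lits : Finset (Fin n × Bool)
  card_le : lits.card ≤ 3

/-- A 3-SAT formula: a list of clauses, in their predefined order. -/
abbrev Formula (n : ℕ) := List (Clause n)

/-- The index in `{1, …, n}` of a variable. -/
def index {n : ℕ} (x : Fin n) : ℕ := x.val + 1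

/-- The assignment `x(V)`: variables with index in `V` are set to `1`, all others to `0`. -/
def assignment (n : ℕ) (V : Finset ℕ) : Fin n → Bool := fun x => decide (index x ∈ V)

/-- Whether a clause is satisfied by an assignment. -/
def Clause.sat {n : ℕ} (C : Clause n) (a : Fin n → Bool) : Bool :=
  decide (∃ p ∈ C.lits, a p.1 = p.2)

/-- The indices of the variables that occur in a clause. -/
def Clause.vars {n : ℕ} (C : Clause n) : Finset ℕ := C.lits.image fun p => index p.1

/-- The variable added to `V` in round `i`.  Let `C` be the first clause of `F` that `x(V)` does
not satisfy.  The choice `c : Fin 3`, which stands for `c + 1 ∈ {1, 2, 3}`, selects the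
`(c+1)`-st smallest index of a variable of `C` that is not in `V`.  If there is no such index, or
no such clause, the dummy variable `n + i` is taken. -/
def nextVar {n : ℕ} (F : Formula n) (V : Finset ℕ) (i : ℕ) (c : Fin 3) : ℕ :=
  match F.find? (fun C => !C.sat (assignment n V)) with
  | some C => ((C.vars \ V).sort (· ≤ ·)).getD c (n + i)
  | none => n + i

/-- The list `v_1, …, v_r` of the variables selected by the choices `s_1, …, s_r`. -/
def flipList {n : ℕ} (F : Formula n) (s : List (Fin 3)) : List ℕ :=
  s.foldl (fun v c => v ++ [nextVar F v.toFinset (v.length + 1) c]) []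

/-! ### Encoding of sets by relative shifts -/

/-- `shifts p [y_1, …, y_k] = [y_1 - p, y_2 - y_1, …, y_k - y_{k-1}]`. -/
def shifts : ℕ → List ℕ → List ℕ
  | _, [] => []
  | p, y :: ys => (y - p) :: shifts y ys

/-- The binary digits of a number without leading zeros, most significant digit first, followed by
the separation character.  Trits are elements of `Fin 3`, and `2` is the separation character. -/
def encNat (d : ℕ) : List (Fin 3) :=
  (Nat.bits d).reverse.map (fun b => if b then 1 else 0) ++ [2]

/-- The trit string encoding `S = {y_1 < … < y_k}` by `y_1, y_2 - y_1, …, y_k - y_{k-1}`. -/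
def encSet (S : Finset ℕ) : List (Fin 3) :=
  (shifts 0 (S.sort (· ≤ ·))).flatMap encNat

/-- The number `⌈k log₂ (n/k)⌉ + 4k` of trits of the register for a set of size `k`. -/
noncomputable def encLen (n k : ℕ) : ℕ := ⌈(k : ℝ) * Real.logb 2 ((n : ℝ) / k)⌉₊ + 4 * k

/-- The content `|enc S⟩` of the register for `S`: its encoding, followed by zeros. -/
noncomputable def encReg (n : ℕ) (S : Finset ℕ) : List (Fin 3) :=
  (encSet S).rightpad (encLen n S.card) 0

/-- The powers of two in the binary expansion of `r`, in descending order. -/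
def blockSizes (r : ℕ) : List ℕ := (Nat.bitIndices r).reverse.map (2 ^ ·)

/-- The number of trits of the register holding `EffEnc V` for `|V| = r`. -/
noncomputable def effEncLen (n r : ℕ) : ℕ := ((blockSizes r).map (encLen n)).sum

/-- `|EffEnc V(s)⟩`: the list `v_1, …, v_r` is cut into consecutive blocks whose sizes are the
powers of two in the binary expansion of `r`, in descending order, and each block is encoded as a
set in a register of its own. -/
noncomputable def effEnc {n : ℕ} (F : Formula n) (s : List (Fin 3)) : List (Fin 3) :=
  ((blockSizes s.length).splitLengths (flipList F s)).flatMap fun B => encReg n B.toFinset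

/-- A trit is stored in two bits: `0 ↦ 00`, `1 ↦ 10`, `2 ↦ 01`. -/
def tritBits (t : Fin 3) : List Bool := [decide (t = 1), decide (t = 2)]

/-- The register of `2 w` bits that stores a string of `w` trits. -/
def tritReg (w : ℕ) (t : List (Fin 3)) : Fin (2 * w) → Bool :=
  fun i => (t.flatMap tritBits).getD i false

/-! ### The registers have the right size -/

theorem length_shifts (p : ℕ) (l : List ℕ) : (shifts p l).length = l.length := by
  induction l generalizing p with
  | nil => rfl
  | cons y ys ih => simp [shifts, ih]

theorem shifts_pos_sum {M : ℕ} (p : ℕ) (l : List ℕ) (hp : p ≤ M)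
    (hl : (p :: l).Pairwise (· < ·)) (hM : ∀ y ∈ l, y ≤ M) :
    (∀ d ∈ shifts p l, 0 < d) ∧ (shifts p l).sum ≤ M - p := by
  induction l generalizing p with
  | nil => simp [shifts]
  | cons y ys ih =>
    have h1 := List.pairwise_cons.1 hl
    have hpy : p < y := h1.1 y (by simp)
    have hy : y ≤ M := hM y (by simp)
    obtain ⟨ha, hb⟩ := ih y hy h1.2 (fun z hz => hM z (by simp [hz]))
    refine ⟨?_, ?_⟩
    · intro d hd
      simp only [shifts, List.mem_cons] at hd
      rcases hd with rfl | hd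
      · omega
      · exact ha d hd
    · simp only [shifts, List.sum_cons]
      omega

theorem length_flatMap_encNat_le {n k : ℕ} (hk : 0 < k) (hkn : k ≤ n) (D : List ℕ)
    (hpos : ∀ d ∈ D, 0 < d) :
    ((D.flatMap encNat).length : ℝ) ≤
      D.length * (Real.logb 2 ((n : ℝ) / k) + 3 - 1 / Real.log 2) +
        D.sum * (k / (2 * n * Real.log 2)) := by
  have hn : (0 : ℝ) < n := by exact_mod_cast hk.trans_le hkn
  have hk' : (0 : ℝ) < k := by exact_mod_cast hk
  have hlog : 0 < Real.log 2 := Real.log_pos (by norm_num)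
  induction D with
  | nil => simp
  | cons d D ih =>
    have ih' := ih (fun e he => hpos e (by simp [he]))
    have hd : 0 < d := hpos d (by simp)
    have hd' : (0 : ℝ) < d := by exact_mod_cast hd
    have hlen : (encNat d).length = d.size + 1 := by simp [encNat, Nat.size_eq_bits_len]
    have hsize : (d.size : ℝ) ≤ Real.logb 2 d + 1 := by
      obtain ⟨m, hm⟩ : ∃ m, d.size = m + 1 :=
        ⟨d.size - 1, by have := Nat.size_pos.2 hd; omega⟩
      have h2 : 2 ^ m ≤ d := Nat.lt_size.1 (by omega)
      have h3 : (m : ℝ) ≤ Real.logb 2 d := by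
        rw [Real.le_logb_iff_rpow_le (by norm_num) hd', Real.rpow_natCast]
        exact_mod_cast h2
      rw [hm]; push_cast; linarith
    have htan : Real.logb 2 d ≤
        Real.logb 2 ((n : ℝ) / k) + 1 + (d * (k / (2 * n * Real.log 2)) - 1 / Real.log 2) := by
      have h4 := Real.log_le_sub_one_of_pos (x := (d : ℝ) * k / (2 * n)) (by positivity)
      have h5 : Real.log ((d : ℝ) * k / (2 * n)) =
          Real.log d - Real.log 2 - Real.log ((n : ℝ) / k) := by
        rw [Real.log_div (by positivity) (by positivity), Real.log_mul (by positivity)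
          (by positivity), Real.log_mul (by positivity) (by positivity),
          Real.log_div (by positivity) (by positivity)]
        ring
      have h6 : Real.log d ≤ Real.log ((n : ℝ) / k) + Real.log 2 + (d * k / (2 * n) - 1) := by
        linarith
      have h7 := div_le_div_of_nonneg_right h6 hlog.le
      simp only [Real.logb]
      refine h7.trans (le_of_eq ?_)
      field_simp
    rw [List.flatMap_cons, List.length_append, hlen, List.length_cons, List.sum_cons]
    simp only [Nat.cast_add, Nat.cast_one]
    nlinarith

/-- The encoding of a set of `k ≤ n` indices in `{1, …, 2n}` fits into its register. -/
theorem length_encSet_le {n : ℕ} (S : Finset ℕ) (hS : ∀ y ∈ S, 0 < y ∧ y ≤ 2 * n)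
    (hcard : S.card ≤ n) : (encSet S).length ≤ encLen n S.card := by
  rcases Nat.eq_zero_or_pos S.card with h0 | hk
  · rw [Finset.card_eq_zero] at h0
    subst h0
    simp [encSet, shifts]
  have hlog : 0 < Real.log 2 := Real.log_pos (by norm_num)
  have hn : (0 : ℝ) < n := by exact_mod_cast hk.trans_le hcard
  have hpw : (0 :: S.sort (· ≤ ·)).Pairwise (· < ·) := by
    refine List.pairwise_cons.2 ⟨fun y hy => (hS y (by simpa using hy)).1, ?_⟩
    exact (Finset.sortedLT_sort S).pairwise
  obtain ⟨hpos, hsum⟩ := shifts_pos_sum (M := 2 * n) 0 (S.sort (· ≤ ·)) (Nat.zero_le _) hpw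
    (fun y hy => (hS y (by simpa using hy)).2)
  have h := length_flatMap_encNat_le hk hcard _ hpos
  rw [length_shifts, Finset.length_sort] at h
  have hsum' : ((shifts 0 (S.sort (· ≤ ·))).sum : ℝ) ≤ 2 * n := by exact_mod_cast hsum
  have h1 : ((shifts 0 (S.sort (· ≤ ·))).sum : ℝ) * (S.card / (2 * n * Real.log 2)) ≤
      2 * n * (S.card / (2 * n * Real.log 2)) :=
    mul_le_mul_of_nonneg_right hsum' (by positivity)
  have h2 : 2 * (n : ℝ) * (S.card / (2 * n * Real.log 2)) = S.card * (1 / Real.log 2) := by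
    field_simp
  have h3 := Nat.le_ceil ((S.card : ℝ) * Real.logb 2 ((n : ℝ) / S.card))
  have h4 : ((encSet S).length : ℝ) ≤ (encLen n S.card : ℝ) := by
    unfold encSet encLen
    push_cast
    have : (0 : ℝ) ≤ S.card := by positivity
    nlinarith
  exact_mod_cast h4

theorem nextVar_spec {n : ℕ} (F : Formula n) (V : Finset ℕ) (i : ℕ) (c : Fin 3) :
    nextVar F V i c = n + i ∨
      (nextVar F V i c ∉ V ∧ 0 < nextVar F V i c ∧ nextVar F V i c ≤ n) := by
  unfold nextVar
  split
  · rename_i C _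
    by_cases h : (c : ℕ) < ((C.vars \ V).sort (· ≤ ·)).length
    · right
      rw [List.getD_eq_getElem _ _ h]
      have hm := List.getElem_mem h
      rw [Finset.mem_sort, Finset.mem_sdiff] at hm
      refine ⟨hm.2, ?_⟩
      obtain ⟨p, _, hp⟩ := Finset.mem_image.1 hm.1
      rw [← hp]
      have := p.1.isLt
      unfold index
      omega
    · left
      rw [List.getD_eq_default _ _ (by omega)]
  · exact Or.inl rfl

/-- The selected variables are distinct, one per round, with indices in `{1, …, n + r}`. -/
theorem flipList_spec {n : ℕ} (F : Formula n) (s : List (Fin 3)) :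
    (flipList F s).length = s.length ∧ (flipList F s).Nodup ∧
      ∀ y ∈ flipList F s, 0 < y ∧ y ≤ n + s.length := by
  induction s using List.reverseRecOn with
  | nil => simp [flipList]
  | append_singleton s c ih =>
    obtain ⟨h1, h2, h3⟩ := ih
    have hstep : flipList F (s ++ [c]) = flipList F s ++
        [nextVar F (flipList F s).toFinset ((flipList F s).length + 1) c] := by
      simp [flipList]
    have hv := nextVar_spec F (flipList F s).toFinset ((flipList F s).length + 1) c
    rw [hstep]
    generalize nextVar F (flipList F s).toFinset ((flipList F s).length + 1) c = v at hv
    have hnot : v ∉ flipList F s := by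
      rcases hv with hv | hv
      · intro hmem
        have := (h3 v hmem).2
        omega
      · simpa using hv.1
    refine ⟨by simp [h1], ?_, ?_⟩
    · rw [List.nodup_append]
      refine ⟨h2, by simp, ?_⟩
      intro a ha b hb
      rw [List.mem_singleton] at hb
      subst hb
      exact fun hab => hnot (hab ▸ ha)
    · intro y hy
      rw [List.mem_append, List.mem_singleton] at hy
      rw [List.length_append, List.length_singleton]
      rcases hy with hy | rfl
      · have := h3 y hy
        omega
      · omega

theorem sum_blockSizes (r : ℕ) : (blockSizes r).sum = r := by
  unfold blockSizes
  rw [List.map_reverse, List.sum_reverse, Nat.sum_map_two_pow_bitIndices]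

/-- For `r ≤ n` rounds, `EffEnc V(s)` fills its register of `effEncLen n r` trits exactly. -/
theorem length_effEnc {n : ℕ} (F : Formula n) (s : List (Fin 3)) (h : s.length ≤ n) :
    (effEnc F s).length = effEncLen n s.length := by
  obtain ⟨h1, h2, h3⟩ := flipList_spec F s
  have hlen := List.map_splitLengths_length (flipList F s) (blockSizes s.length)
    (by rw [sum_blockSizes, h1])
  have hflat := List.flatten_splitLengths (flipList F s) (blockSizes s.length)
    (by rw [sum_blockSizes, h1])
  unfold effEnc effEncLen
  rw [List.length_flatMap]
  conv_rhs => rw [← hlen, List.map_map]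
  congr 1
  refine List.map_congr_left fun B hB => ?_
  have hsub : B.Sublist (flipList F s) := by
    rw [← hflat]
    exact List.sublist_flatten_of_mem hB
  have hBc : B.toFinset.card = B.length := List.toFinset_card_of_nodup (h2.sublist hsub)
  have hle : B.length ≤ n := hsub.length_le.trans (h1 ▸ h)
  have hfit := length_encSet_le (n := n) B.toFinset
    (fun y hy => by
      have := h3 y (hsub.subset (List.mem_toFinset.1 hy))
      omega) (by omega)
  simp only [encReg, List.length_rightpad, Function.comp]
  rw [max_eq_left hfit, hBc]

end QBall

/-!
A Boolean function that is defined by a bounded number of nested counts `#{P ∈ L | P x} = K` is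
computed by a reversible circuit of polynomial size that needs, at every level of the nesting, one
counter of `O(log n)` bits and one flag, which are uncomputed by the inverse circuit.  Decoding the
registers, testing the clauses, selecting the variable and encoding the result have bounded depth
in this sense, so a single round costs `O(log n)` ancillas.

Storing the selected variables one by one would need `r log n` bits.  Instead, a block of `2 ^ e`
rounds is computed from its two halves, each of which is stored as an encoded set in a temporary
register; the halves are merged into the target register and then uncomputed.  Since every half is
run twice, a block costs at most `8 ^ e` times the gates of one round, which is polynomial.  The
temporary registers that are in use at the same time have lengths `2 ^ i * (log (n / 2 ^ i) + O(1))`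
for `i < e`, each occurring twice, and this sum is dominated by its last terms, so it is
`O(r log (n / r) + r)`.  The blocks of `EffEnc` are computed one after the other.
-/

namespace QBall

/-! ### Circuits on wires numbered by natural numbers -/

/-- A NOT, CNOT or Toffoli gate on wires numbered by natural numbers. Unlike `Gate m`, it does not
fix the number of wires, so that circuits can be moved to larger registers without casts. -/
inductive WireGate where
  | not (t : ℕ)
  | cnot (c t : ℕ)
  | toffoli (c₁ c₂ t : ℕ)

/-- The action of a gate on the values of all wires. -/
def WireGate.apply : WireGate → (ℕ → Bool) → (ℕ → Bool)
  | .not t, x => Function.update x t (!x t)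
  | .cnot c t, x => Function.update x t (xor (x t) (x c))
  | .toffoli c₁ c₂ t, x => Function.update x t (xor (x t) (x c₁ && x c₂))

/-- The gate is a legal gate on the first `m` wires. -/
def WireGate.Ok (m : ℕ) : WireGate → Prop
  | .not t => t < m
  | .cnot c t => c < m ∧ t < m ∧ c ≠ t
  | .toffoli c₁ c₂ t => c₁ < m ∧ c₂ < m ∧ t < m ∧ c₁ ≠ c₂ ∧ c₁ ≠ t ∧ c₂ ≠ t

theorem WireGate.Ok.mono {m m' : ℕ} (h : m ≤ m') {g : WireGate} (hg : g.Ok m) : g.Ok m' := by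
  cases g <;> simp only [WireGate.Ok] at * <;> omega

theorem WireGate.apply_apply {m : ℕ} {g : WireGate} (hg : g.Ok m) (x : ℕ → Bool) :
    g.apply (g.apply x) = x := by
  cases g with
  | not t => simp [WireGate.apply]
  | cnot c t => simp [WireGate.apply, Function.update_of_ne hg.2.2]
  | toffoli c₁ c₂ t =>
    obtain ⟨-, -, -, -, h₁, h₂⟩ := hg
    simp [WireGate.apply, Function.update_of_ne h₁, Function.update_of_ne h₂]

theorem WireGate.Ok.exists_gate {m : ℕ} {g : WireGate} (hg : g.Ok m) :
    ∃ g' : Gate m, ∀ x : ℕ → Bool, g'.apply (fun i => x i) = fun i : Fin m => g.apply x i := by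
  have update_val (x : ℕ → Bool) (t : Fin m) (b : Bool) :
      Function.update (fun i : Fin m => x i) t b = fun i : Fin m => Function.update x t b i :=
    (Function.update_comp_eq_of_injective x Fin.val_injective t b).symm
  cases g with
  | not t => exact ⟨.not ⟨t, hg⟩, fun x => update_val _ _ _⟩
  | cnot c t =>
    obtain ⟨hc, ht, hct⟩ := hg
    exact ⟨.cnot ⟨c, hc⟩ ⟨t, ht⟩ (by simpa using hct), fun x => update_val _ _ _⟩
  | toffoli c₁ c₂ t =>
    obtain ⟨hc₁, hc₂, ht, h₁₂, h₁, h₂⟩ := hg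
    exact ⟨.toffoli ⟨c₁, hc₁⟩ ⟨c₂, hc₂⟩ ⟨t, ht⟩ (by simpa using h₁₂) (by simpa using h₁)
      (by simpa using h₂), fun x => update_val _ _ _⟩

/-- The action of a sequence of gates, run from left to right. -/
def runWires (c : List WireGate) (x : ℕ → Bool) : ℕ → Bool :=
  c.foldl (fun y g => g.apply y) x

theorem runWires_cons (g : WireGate) (c : List WireGate) (x : ℕ → Bool) :
    runWires (g :: c) x = runWires c (g.apply x) := rfl

theorem runWires_append (c c' : List WireGate) (x : ℕ → Bool) :
    runWires (c ++ c') x = runWires c' (runWires c x) :=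
  List.foldl_append

theorem runWires_reverse {m : ℕ} {c : List WireGate} (hc : ∀ g ∈ c, g.Ok m) (x : ℕ → Bool) :
    runWires c.reverse (runWires c x) = x := by
  induction c generalizing x with
  | nil => rfl
  | cons g c ih =>
    rw [List.forall_mem_cons] at hc
    rw [List.reverse_cons, runWires_append, runWires_cons g c, ih hc.2]
    exact WireGate.apply_apply hc.1 x

theorem exists_circuit {m : ℕ} (c : List WireGate) (hc : ∀ g ∈ c, g.Ok m) :
    ∃ c' : Circuit m, c'.length = c.length ∧
      ∀ x : ℕ → Bool, c'.run (fun i => x i) = fun i : Fin m => runWires c x i := by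
  induction c with
  | nil => exact ⟨[], rfl, fun _ => rfl⟩
  | cons g c ih =>
    rw [List.forall_mem_cons] at hc
    obtain ⟨c', hlen, hrun⟩ := ih hc.2
    obtain ⟨g', hg'⟩ := hc.1.exists_gate
    refine ⟨g' :: c', by rw [List.length_cons, List.length_cons, hlen], fun x => ?_⟩
    calc Circuit.run (g' :: c') (fun i => x i) = c'.run (g'.apply fun i => x i) := rfl
      _ = fun i : Fin m => runWires (g :: c) x i := by rw [hg', hrun, runWires_cons]

/-- Some circuit of at most `g` gates on the first `m` wires takes `x` to `y` whenever `R x y`.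
Preconditions such as ancillas being zero are part of the relation `R`. -/
def HasCircuit (m g : ℕ) (R : (ℕ → Bool) → (ℕ → Bool) → Prop) : Prop :=
  ∃ c : List WireGate, c.length ≤ g ∧ (∀ g ∈ c, g.Ok m) ∧ ∀ x y, R x y → runWires c x = y

namespace HasCircuit

variable {m g g' : ℕ} {R R' : (ℕ → Bool) → (ℕ → Bool) → Prop}

theorem mono {m' : ℕ} (h : HasCircuit m g R) (hm : m ≤ m') (hg : g ≤ g')
    (hR : ∀ x y, R' x y → R x y) : HasCircuit m' g' R' := by
  obtain ⟨c, hlen, hok, hrun⟩ := h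
  exact ⟨c, hlen.trans hg, fun b hb => (hok b hb).mono hm, fun x y hxy => hrun x y (hR x y hxy)⟩

theorem of_gate {b : WireGate} (hb : b.Ok m) : HasCircuit m 1 fun x y => b.apply x = y :=
  ⟨[b], le_rfl, by simpa using hb, fun _ _ h => h⟩

theorem refl : HasCircuit m 0 Eq :=
  ⟨[], le_rfl, by simp, fun _ _ h => h⟩

theorem comp (h : HasCircuit m g R) (h' : HasCircuit m g' R') :
    HasCircuit m (g + g') (Relation.Comp R R') := by
  obtain ⟨c, hlen, hok, hrun⟩ := h
  obtain ⟨c', hlen', hok', hrun'⟩ := h'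
  refine ⟨c ++ c', by rw [List.length_append]; omega, ?_, ?_⟩
  · exact List.forall_mem_append.2 ⟨hok, hok'⟩
  · rintro x z ⟨y, hxy, hyz⟩
    rw [runWires_append, hrun x y hxy, hrun' y z hyz]

theorem symm (h : HasCircuit m g R) : HasCircuit m g fun x y => R y x := by
  obtain ⟨c, hlen, hok, hrun⟩ := h
  refine ⟨c.reverse, by rwa [List.length_reverse], by simpa using hok, fun x y hyx => ?_⟩
  rw [← hrun y x hyx, runWires_reverse hok]

/-- Compute, use the result, uncompute. -/
theorem conj (h : HasCircuit m g R) (h' : HasCircuit m g' R') :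
    HasCircuit m (2 * g + g') fun x x' => ∃ y y', R x y ∧ R' y y' ∧ R x' y' :=
  ((h.comp h').comp h.symm).mono le_rfl (by omega) fun _ _ ⟨y, y', hxy, hyy', hx'y'⟩ =>
    ⟨y', ⟨y, hxy, hyy'⟩, hx'y'⟩

end HasCircuit

/-! ### Registers -/

/-- The `a` wires from `N` on are zero. -/
def Clean (N a : ℕ) (x : ℕ → Bool) : Prop := ∀ i, N ≤ i → i < N + a → x i = false

/-- Replace the content of the register of `k` wires that begins at the wire `o` by `v`. -/
def setReg (o k : ℕ) (v : ℕ → Bool) (x : ℕ → Bool) : ℕ → Bool :=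
  fun i => if o ≤ i ∧ i < o + k then v (i - o) else x i

section Registers

variable {o k i : ℕ} {v x : ℕ → Bool}

theorem setReg_of_notMem (h : i < o ∨ o + k ≤ i) : setReg o k v x i = x i :=
  if_neg (by omega)

theorem setReg_update_of_notMem {b : Bool} (h : i < o ∨ o + k ≤ i) :
    setReg o k v (Function.update x i b) = Function.update (setReg o k v x) i b := by
  funext j
  simp only [setReg, Function.update_apply]
  split_ifs <;> first | rfl | omega

theorem setReg_zero : setReg o 0 v x = x :=
  funext fun _ => if_neg (by omega)

theorem setReg_succ : setReg o (k + 1) v x =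
    setReg (o + 1) k (fun j => v (j + 1)) (Function.update x o (v 0)) := by
  funext i
  simp only [setReg, Function.update_apply]
  rcases lt_trichotomy i o with h | rfl | h
  · split_ifs <;> first | rfl | omega
  · simp
  · have : i - (o + 1) + 1 = i - o := by omega
    split_ifs <;> first | rfl | omega | rw [this]

theorem Clean.mono {N a N' a' : ℕ} (h : Clean N a x) (hN : N ≤ N') (ha : N' + a' ≤ N + a) :
    Clean N' a' x :=
  fun i hi hi' => h i (by omega) (by omega)

theorem Clean.congr {N a : ℕ} {y : ℕ → Bool} (h : Clean N a x)
    (hxy : ∀ i, N ≤ i → i < N + a → y i = x i) : Clean N a y :=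
  fun i hi hi' => (hxy i hi hi').trans (h i hi hi')

theorem Clean.update {N a : ℕ} {b : Bool} (h : Clean N a x) (hi : i < N ∨ N + a ≤ i) :
    Clean N a (Function.update x i b) :=
  h.congr fun _ _ _ => Function.update_of_ne (by omega) _ _

theorem Clean.setReg_false (h : Clean o k x) : setReg o k (fun _ => false) x = x := by
  funext i
  unfold setReg
  split_ifs with hi
  · exact (h i hi.1 hi.2).symm
  · rfl

end Registers

/-! ### Counters -/

theorem add_toNat_div_two (v : ℕ) (b : Bool) :
    (v + b.toNat) / 2 = v / 2 + (b && v.testBit 0).toNat := by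
  rw [Nat.testBit_zero]
  rcases Nat.mod_two_eq_zero_or_one v with h | h <;> cases b <;> simp [h] <;> omega

theorem testBit_zero_add_toNat (v : ℕ) (b : Bool) :
    (v + b.toNat).testBit 0 = xor (v.testBit 0) b := by
  rw [Nat.testBit_zero, Nat.testBit_zero]
  rcases Nat.mod_two_eq_zero_or_one v with h | h <;> cases b <;> simp [Nat.add_mod, h]

theorem eq_iff_testBit_eq_of_lt {w u v : ℕ} (hu : u < 2 ^ w) (hv : v < 2 ^ w) :
    u = v ↔ ∀ i < w, u.testBit i = v.testBit i := by
  refine ⟨fun h _ _ => h ▸ rfl, fun h => Nat.eq_of_testBit_eq fun i => ?_⟩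
  rcases lt_or_ge i w with hi | hi
  · exact h i hi
  · have hpow : 2 ^ w ≤ 2 ^ i := Nat.pow_le_pow_right two_pos hi
    rw [Nat.testBit_eq_false_of_lt (hu.trans_le hpow),
      Nat.testBit_eq_false_of_lt (hv.trans_le hpow)]

theorem setReg_testBit_succ (c w v : ℕ) (x : ℕ → Bool) :
    setReg c (w + 1) v.testBit x =
      setReg (c + 1) w (v / 2).testBit (Function.update x c (v.testBit 0)) := by
  simp only [setReg_succ, Nat.testBit_succ]

/-- The carry out of the lowest digit is computed into the wire `a`, which then controls the
increment of the remaining digits. -/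
theorem hasCircuit_increment {m w φ c a : ℕ} (hφc : φ < c ∨ c + w ≤ φ) (hφa : φ < a)
    (hca : c + w ≤ a) (ham : a + w ≤ m) :
    HasCircuit m (3 * w) fun x y => ∃ v z, Clean a w z ∧ x = setReg c w v.testBit z ∧
      y = setReg c w (v + (z φ).toNat).testBit z := by
  induction w generalizing φ c a with
  | zero =>
    refine HasCircuit.refl.mono (Nat.zero_le m) le_rfl ?_
    rintro _ _ ⟨v, z, -, rfl, rfl⟩
    rw [setReg_zero, setReg_zero]
  | succ w ih =>
    have carry := HasCircuit.of_gate (m := m) (b := .toffoli φ c a)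
      ⟨by omega, by omega, by omega, by omega, by omega, by omega⟩
    have flip := HasCircuit.of_gate (m := m) (b := .cnot φ c) ⟨by omega, by omega, by omega⟩
    have rest := ih (φ := a) (c := c + 1) (a := a + 1) (by omega) (by omega) (by omega) (by omega)
    refine ((carry.conj rest).comp flip).mono le_rfl (by omega) ?_
    rintro _ _ ⟨v, z, hz, rfl, rfl⟩
    have hza : z a = false := hz a le_rfl (by omega)
    have apply_carry (u : ℕ) (b : Bool) : WireGate.apply (.toffoli φ c a)
        (setReg (c + 1) w u.testBit (Function.update z c b)) =
          setReg (c + 1) w u.testBit (Function.update (Function.update z c b) a (z φ && b)) := by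
      simp only [WireGate.apply]
      rw [setReg_update_of_notMem (i := a) (by omega), setReg_of_notMem (i := a) (by omega),
        setReg_of_notMem (i := φ) (by omega),
        setReg_of_notMem (i := c) (by omega), Function.update_of_ne (by omega : a ≠ c),
        Function.update_of_ne (by omega : φ ≠ c), Function.update_self, hza, Bool.false_xor]
    refine ⟨setReg (c + 1) w (v / 2 + (z φ && v.testBit 0).toNat).testBit
      (Function.update z c (v.testBit 0)), ⟨_, _, ?_, ⟨v / 2, Function.update (Function.update z c
        (v.testBit 0)) a (z φ && v.testBit 0), ?_, rfl, rfl⟩, ?_⟩, ?_⟩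
    · rw [setReg_testBit_succ, apply_carry]
    · exact ((hz.mono (by omega) (by omega)).update (by omega)).update (by omega)
    · rw [apply_carry, Function.update_self]
    · simp only [WireGate.apply]
      rw [setReg_testBit_succ, add_toNat_div_two, testBit_zero_add_toNat,
        setReg_of_notMem (i := c) (by omega), setReg_of_notMem (i := φ) (by omega),
        Function.update_self, Function.update_of_ne (by omega : φ ≠ c),
        ← setReg_update_of_notMem (by omega), Function.update_idem]

theorem hasCircuit_xor_const {m c : ℕ} (hc : c < m) (b : Bool) :
    HasCircuit m 1 fun x y => y = Function.update x c (xor (x c) b) := by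
  cases b with
  | false =>
    refine HasCircuit.refl.mono (Nat.zero_le m) (Nat.zero_le 1) ?_
    rintro x _ rfl
    simp
  | true =>
    refine (HasCircuit.of_gate (b := .not c) hc).mono le_rfl le_rfl ?_
    rintro x _ rfl
    simp [WireGate.apply]

/-- Whether the lowest digit agrees with `v 0` is computed into the wire `a`, which then controls
the comparison of the remaining digits. -/
theorem hasCircuit_compare {m w t φ c a : ℕ} (v : ℕ → Bool) (htc : t < c) (htφ : t ≠ φ)
    (hφc : φ < c ∨ c + w ≤ φ) (hφa : φ < a) (hca : c + w ≤ a) (ham : a + w ≤ m) :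
    HasCircuit m (4 * w + 1) fun x y => Clean a w x ∧
      y = Function.update x t (xor (x t) (x φ && decide (∀ i < w, x (c + i) = v i))) := by
  induction w generalizing φ c a v with
  | zero =>
    refine (HasCircuit.of_gate (b := .cnot φ t) ⟨by omega, by omega, htφ.symm⟩).mono le_rfl
      (by omega) ?_
    rintro x _ ⟨-, rfl⟩
    simp [WireGate.apply]
  | succ w ih =>
    have agree := (hasCircuit_xor_const (m := m) (c := c) (by omega) (!v 0)).comp
      (HasCircuit.of_gate (b := .toffoli φ c a)
        ⟨by omega, by omega, by omega, by omega, by omega, by omega⟩)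
    have rest := ih (φ := a) (c := c + 1) (a := a + 1) (fun i => v (i + 1)) (by omega) (by omega)
      (by omega) (by omega) (by omega) (by omega)
    refine (agree.conj rest).mono le_rfl (by omega) ?_
    rintro x _ ⟨hx, rfl⟩
    have hxa : x a = false := hx a le_rfl (by omega)
    have all_digits : decide (∀ i < w + 1, x (c + i) = v i) =
        (xor (x c) (!v 0) && decide (∀ i < w, x (c + 1 + i) = v (i + 1))) := by
      rw [Bool.eq_iff_iff]
      simp only [decide_eq_true_eq, Bool.and_eq_true, Nat.forall_lt_succ_left, add_zero,
        add_assoc, add_comm 1]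
      cases x c <;> cases v 0 <;> simp
    set y := Function.update (Function.update x c (xor (x c) (!v 0))) a
      (x φ && xor (x c) (!v 0)) with hy
    have y_of_ne {i : ℕ} (hic : i ≠ c) (hia : i ≠ a) : y i = x i := by
      rw [hy, Function.update_of_ne hia, Function.update_of_ne hic]
    refine ⟨y, _, ⟨_, rfl, ?_⟩, ⟨?_, rfl⟩, ⟨_, rfl, ?_⟩⟩
    · simp [WireGate.apply, hy, hxa, Function.update_of_ne (by omega : φ ≠ c),
        Function.update_of_ne (by omega : a ≠ c)]
    · exact ((hx.mono (by omega) (by omega)).update (by omega)).update (by omega)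
    · have digits_y : (∀ i < w, y (c + 1 + i) = v (i + 1)) ↔
          ∀ i < w, x (c + 1 + i) = v (i + 1) :=
        forall₂_congr fun i hi => by rw [y_of_ne (by omega) (by omega)]
      have hya : y a = (x φ && xor (x c) (!v 0)) := Function.update_self ..
      simp only [y_of_ne (by omega : t ≠ c) (by omega : t ≠ a), digits_y, hya, all_digits,
        Bool.and_assoc]
      funext i
      simp only [WireGate.apply, Function.update_apply, hy]
      split_ifs <;> first | omega | simp_all

theorem hasCircuit_compare_of_clean {m w t φ c a : ℕ} (v : ℕ → Bool) (htφ : t < φ) (hφc : φ < c)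
    (hca : c + w ≤ a) (ham : a + w ≤ m) :
    HasCircuit m (4 * w + 3) fun x y => x φ = false ∧ Clean a w x ∧
      y = Function.update x t (xor (x t) (decide (∀ i < w, x (c + i) = v i))) := by
  refine ((HasCircuit.of_gate (m := m) (b := .not φ) (by change φ < m; omega)).conj
    (hasCircuit_compare (t := t) (φ := φ) v (by omega) (by omega) (by omega) (by omega) hca
      ham)).mono le_rfl (by omega) ?_
  rintro x _ ⟨hxφ, hx, rfl⟩
  have hne : t ≠ φ := by omega
  have digits (b : Bool) :
      (∀ i < w, Function.update x φ b (c + i) = v i) ↔ ∀ i < w, x (c + i) = v i :=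
    forall₂_congr fun i _ => by rw [Function.update_of_ne (by omega)]
  refine ⟨Function.update x φ true, _, ?_, ⟨hx.update (by omega), rfl⟩, ?_⟩
  · simp [WireGate.apply, hxφ]
  · simp only [WireGate.apply, digits, Function.update_self, Function.update_of_ne hne,
      Function.update_of_ne hne.symm, Function.update_comm hne, hxφ,
      Bool.not_false, Bool.true_and]

/-! ### Predicates computed by nested counting -/

open Classical in
/-- The predicate `P` depends only on the wires in `D`, and is decided by `d` nested levels of
counting in counters of `w` bits: if all wires from `N` on are free, then a circuit with at most
`2 ^ (8 * w * d)` gates adds `P` to any wire `t` outside `D`, using the `d * (2 * w + 1)` wires from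
`N` on as ancillas. Each level takes a counter, its carries and the bit that is to be counted. -/
def HasDepth (w : ℕ) (D : Set ℕ) (d : ℕ) (P : (ℕ → Bool) → Prop) : Prop :=
  DependsOn P D ∧ ∀ t N, t ∉ D → t < N → (∀ i ∈ D, i < N) →
    HasCircuit (N + d * (2 * w + 1)) (2 ^ (8 * w * d)) fun x y =>
      Clean N (d * (2 * w + 1)) x ∧ y = Function.update x t (xor (x t) (decide (P x)))

theorem counting_gates_le {w : ℕ} (hw : 0 < w) {l : ℕ} (hl : l ≤ 2 ^ w) (d : ℕ) :
    2 * (l * (2 * 2 ^ (8 * w * d) + 3 * w)) + (4 * w + 3) ≤ 2 ^ (8 * w * (d + 1)) := by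
  have hpow : 2 ^ (8 * w * (d + 1)) = (2 ^ w) ^ 8 * 2 ^ (8 * w * d) := by
    rw [← pow_mul, ← pow_add]
    ring_nf
  have hwM : w ≤ 2 ^ w := Nat.lt_two_pow_self.le
  have hM : 2 ≤ 2 ^ w := Nat.le_self_pow hw.ne' 2
  have hG : 1 ≤ 2 ^ (8 * w * d) := Nat.one_le_two_pow
  rw [hpow]
  generalize 2 ^ (8 * w * d) = G at *
  generalize 2 ^ w = M at *
  have hMG : M ≤ M * G := Nat.le_mul_of_pos_right M hG
  have hMMG : M * G ≤ M * M * G := by nlinarith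
  calc 2 * (l * (2 * G + 3 * w)) + (4 * w + 3) ≤ 2 * (M * (2 * G + 3 * (M * G))) + 6 * (M * G) := by
        gcongr 2 * (?_ * (_ + 3 * ?_)) + ?_ <;> omega
    _ ≤ 2 ^ 6 * (M * M * G) := by nlinarith
    _ ≤ M ^ 6 * (M * M * G) := by gcongr
    _ = M ^ 8 * G := by ring

namespace HasDepth

variable {w d : ℕ} {D : Set ℕ} {P : (ℕ → Bool) → Prop}

theorem mono {d' : ℕ} (h : HasDepth w D d P) (hd : d ≤ d') : HasDepth w D d' P := by
  refine ⟨h.1, fun t N htD htN hD => (h.2 t N htD htN hD).mono ?_ ?_ ?_⟩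
  · gcongr
  · gcongr
    exact one_le_two
  · rintro x y ⟨hx, rfl⟩
    exact ⟨hx.mono le_rfl (by gcongr), rfl⟩

theorem congr {Q : (ℕ → Bool) → Prop} (h : HasDepth w D d P) (hPQ : ∀ x, P x ↔ Q x) :
    HasDepth w D d Q := by
  rwa [← funext fun x => propext (hPQ x)]

theorem wire {i : ℕ} (hi : i ∈ D) : HasDepth w D 0 (fun x => x i = true) := by
  refine ⟨fun _ _ hxy => by simp only [hxy i hi], fun t N htD htN hD => ?_⟩
  have hit : i ≠ t := fun h => htD (h ▸ hi)
  refine (HasCircuit.of_gate (b := .cnot i t) ⟨hD i hi, htN, hit⟩).mono (by omega) (by simp) ?_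
  rintro x y ⟨-, rfl⟩
  simp [WireGate.apply]

theorem const_false : HasDepth w D 0 (fun _ => False) := by
  refine ⟨fun _ _ _ => rfl, fun _ _ _ _ _ => HasCircuit.refl.mono (Nat.zero_le _) (by simp) ?_⟩
  rintro x y ⟨-, rfl⟩
  simp

open Classical in
theorem hasCircuit_count (hP : HasDepth w D d P) {N : ℕ} (hD : ∀ i ∈ D, i < N) :
    HasCircuit (N + (d + 1) * (2 * w + 1)) (2 * 2 ^ (8 * w * d) + 3 * w) fun x y =>
      ∃ v z, Clean N ((d + 1) * (2 * w + 1)) z ∧ x = setReg (N + 1) w v.testBit z ∧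
        y = setReg (N + 1) w (v + (decide (P z)).toNat).testBit z := by
  have hwires : N + (d + 1) * (2 * w + 1) = N + 1 + 2 * w + d * (2 * w + 1) := by ring
  have decideP := hP.2 N (N + 1 + 2 * w) (fun h => (hD N h).false) (by omega)
    (fun i hi => by have := hD i hi; omega)
  have increment := hasCircuit_increment (m := N + 1 + 2 * w + d * (2 * w + 1)) (w := w) (φ := N)
    (c := N + 1) (a := N + 1 + w) (by omega) (by omega) (by omega) (by omega)
  rw [hwires]
  refine (decideP.conj increment).mono le_rfl le_rfl ?_
  rintro _ _ ⟨v, z, hz, rfl, rfl⟩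
  have hzN : z N = false := hz N le_rfl (by omega)
  have clean_setReg (u : ℕ) :
      Clean (N + 1 + 2 * w) (d * (2 * w + 1)) (setReg (N + 1) w u.testBit z) :=
    (hz.mono (by omega) (by omega)).congr fun i _ _ => setReg_of_notMem (by omega)
  have flip_indicator (u : ℕ) : setReg (N + 1) w u.testBit (Function.update z N (decide (P z))) =
      Function.update (setReg (N + 1) w u.testBit z) N
        (xor (setReg (N + 1) w u.testBit z N) (decide (P (setReg (N + 1) w u.testBit z)))) := by
    have hPz : P (setReg (N + 1) w u.testBit z) = P z :=
      hP.1 fun i hi => setReg_of_notMem (.inl (by have := hD i hi; omega))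
    rw [setReg_update_of_notMem (.inl (by omega)), setReg_of_notMem (i := N) (.inl (by omega)), hzN]
    simp only [hPz, Bool.false_xor]
  refine ⟨_, _, ⟨clean_setReg v, flip_indicator v⟩,
    ⟨v, Function.update z N (decide (P z)), ?_, rfl, rfl⟩, clean_setReg _, ?_⟩
  · exact (hz.mono (by omega) (by omega)).update (by omega)
  · rw [Function.update_self, flip_indicator]

open Classical in
theorem hasCircuit_countP (L : List ((ℕ → Bool) → Prop)) (hL : ∀ P ∈ L, HasDepth w D d P) {N : ℕ}
    (hD : ∀ i ∈ D, i < N) :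
    HasCircuit (N + (d + 1) * (2 * w + 1)) (L.length * (2 * 2 ^ (8 * w * d) + 3 * w)) fun x y =>
      ∃ v z, Clean N ((d + 1) * (2 * w + 1)) z ∧ x = setReg (N + 1) w v.testBit z ∧
        y = setReg (N + 1) w (v + L.countP fun P => decide (P z)).testBit z := by
  induction L with
  | nil =>
    refine HasCircuit.refl.mono (Nat.zero_le _) (Nat.zero_le _) ?_
    rintro _ _ ⟨v, z, -, rfl, rfl⟩
    rfl
  | cons P L ih =>
    rw [List.forall_mem_cons] at hL
    refine ((hL.1.hasCircuit_count hD).comp (ih hL.2)).mono le_rfl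
      (by rw [List.length_cons]; exact (by ring : _ = _).le) ?_
    rintro _ _ ⟨v, z, hz, rfl, rfl⟩
    refine ⟨_, ⟨v, z, hz, rfl, rfl⟩, v + (decide (P z)).toNat, z, hz, rfl, ?_⟩
    rw [List.countP_cons, add_assoc, add_comm (Bool.toNat _)]
    congr 3
    cases decide (P z) <;> rfl

open Classical in
theorem countP_eq (hw : 0 < w) (L : List ((ℕ → Bool) → Prop)) (hL : ∀ P ∈ L, HasDepth w D d P)
    (hlen : L.length < 2 ^ w) (k : ℕ) :
    HasDepth w D (d + 1) (fun x => (L.countP fun P => decide (P x)) = k) := by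
  have hcount (x : ℕ → Bool) : (L.countP fun P => decide (P x)) < 2 ^ w :=
    L.countP_le_length.trans_lt hlen
  rcases le_or_gt (2 ^ w) k with hk | hk
  · refine (const_false.mono (Nat.zero_le _)).congr fun x => ?_
    simp only [false_iff]
    exact ((hcount x).trans_le hk).ne
  have hdep (x y : ℕ → Bool) (hxy : ∀ i ∈ D, x i = y i) :
      (L.countP fun P => decide (P x)) = L.countP fun P => decide (P y) :=
    List.countP_congr fun P hP => by simp only [decide_eq_true_eq, (hL P hP).1 hxy]
  refine ⟨fun x y hxy => congrArg (· = k) (hdep x y hxy), fun t N htD htN hD => ?_⟩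
  have hwires : N + (d + 1) * (2 * w + 1) = N + 1 + 2 * w + d * (2 * w + 1) := by ring
  have compare := hasCircuit_compare_of_clean (m := N + (d + 1) * (2 * w + 1)) (w := w) (t := t)
    (φ := N) (c := N + 1) (a := N + 1 + w) k.testBit htN (by omega) (by omega) (by omega)
  refine ((hasCircuit_countP L hL hD).conj compare).mono le_rfl
    (counting_gates_le hw hlen.le d) ?_
  rintro x _ ⟨hx, rfl⟩
  set K := L.countP fun P => decide (P x) with hK
  have count_update (b : Bool) : ∃ v z, Clean N ((d + 1) * (2 * w + 1)) z ∧
      Function.update x t b = setReg (N + 1) w v.testBit z ∧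
        setReg (N + 1) w K.testBit (Function.update x t b) =
          setReg (N + 1) w (v + L.countP fun P => decide (P z)).testBit z := by
    have hclean : Clean N ((d + 1) * (2 * w + 1)) (Function.update x t b) := hx.update (.inl htN)
    refine ⟨0, Function.update x t b, hclean, ?_, ?_⟩
    · rw [show Nat.testBit 0 = fun _ => false from funext Nat.zero_testBit,
        Clean.setReg_false (hclean.mono (by omega) (by omega))]
    · rw [zero_add, hK, hdep (Function.update x t b) x fun i hi =>
        Function.update_of_ne (ne_of_mem_of_not_mem hi htD) _ _]
  have digits : (∀ i < w, setReg (N + 1) w K.testBit x (N + 1 + i) = k.testBit i) ↔ K = k := by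
    refine Iff.trans (forall₂_congr fun i hi => ?_) (eq_iff_testBit_eq_of_lt (hcount x) hk).symm
    rw [setReg, if_pos (by omega), Nat.add_sub_cancel_left]
  refine ⟨setReg (N + 1) w K.testBit x, _, by simpa using count_update (x t), ⟨?_, ?_, rfl⟩, ?_⟩
  · rw [setReg_of_notMem (by omega), hx N le_rfl (by omega)]
  · exact (hx.mono (by omega) (by omega)).congr fun i _ _ => setReg_of_notMem (by omega)
  · rw [setReg_of_notMem (i := t) (by omega), ← setReg_update_of_notMem (by omega)]
    convert count_update _

open Classical in
theorem sum_eq {ι : Type*} (hw : 0 < w) (s : Finset ι) (wt : ι → ℕ)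
    {P : ι → (ℕ → Bool) → Prop} (hP : ∀ i ∈ s, HasDepth w D d (P i))
    (hs : ∑ i ∈ s, wt i < 2 ^ w) (k : ℕ) :
    HasDepth w D (d + 1) (fun x => (∑ i ∈ s, if P i x then wt i else 0) = k) := by
  have hL : ∀ Q ∈ s.toList.flatMap fun i => List.replicate (wt i) (P i), HasDepth w D d Q := by
    simp only [List.mem_flatMap, Finset.mem_toList, forall_exists_index, and_imp]
    intro Q i hi hQ
    exact List.eq_of_mem_replicate hQ ▸ hP i hi
  refine (countP_eq hw _ hL ?_ k).congr fun x => ?_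
  · simpa [List.length_flatMap, Finset.sum_map_toList] using hs
  · rw [List.countP_flatMap, ← Finset.sum_map_toList]
    congr! 4
    simp [List.countP_replicate]

open Classical in
theorem card_eq {ι : Type*} (hw : 0 < w) (s : Finset ι)
    {P : ι → (ℕ → Bool) → Prop} (hP : ∀ i ∈ s, HasDepth w D d (P i))
    (hs : s.card < 2 ^ w) (k : ℕ) :
    HasDepth w D (d + 1) (fun x => (s.filter fun i => P i x).card = k) := by
  refine (sum_eq hw s (fun _ => 1) hP (by simpa using hs) k).congr fun x => ?_
  rw [Finset.card_filter]

theorem forall_mem {ι : Type*} (hw : 0 < w) (s : Finset ι)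
    {P : ι → (ℕ → Bool) → Prop} (hP : ∀ i ∈ s, HasDepth w D d (P i))
    (hs : s.card < 2 ^ w) : HasDepth w D (d + 1) (fun x => ∀ i ∈ s, P i x) := by
  classical
  exact (card_eq hw s hP hs s.card).congr fun x => Finset.card_filter_eq_iff

theorem not (hw : 0 < w) (hP : HasDepth w D d P) : HasDepth w D (d + 1) (fun x => ¬P x) := by
  classical
  refine (card_eq hw {()} (P := fun _ => P) (fun _ _ => hP) ?_ 0).congr fun x => ?_
  · simpa using hw.ne'
  · simp [Finset.filter_singleton]

theorem exists_mem {ι : Type*} (hw : 0 < w) (s : Finset ι)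
    {P : ι → (ℕ → Bool) → Prop} (hP : ∀ i ∈ s, HasDepth w D d (P i))
    (hs : s.card < 2 ^ w) : HasDepth w D (d + 2) (fun x => ∃ i ∈ s, P i x) := by
  classical
  refine ((card_eq hw s hP hs 0).not hw).congr fun x => ?_
  simp [Finset.card_eq_zero, Finset.filter_eq_empty_iff]

theorem const (hw : 0 < w) (p : Prop) : HasDepth w D (d + 1) (fun _ => p) := by
  by_cases hp : p
  · exact ((const_false.not hw).mono (by omega)).congr fun _ => by simp [hp]
  · exact (const_false.mono (Nat.zero_le _)).congr fun _ => by simp [hp]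

theorem const_and {p : Prop} (hP : p → HasDepth w D d P) : HasDepth w D d (fun x => p ∧ P x) := by
  by_cases hp : p
  · exact (hP hp).congr fun x => by simp [hp]
  · exact (const_false.mono (Nat.zero_le _)).congr fun x => by simp [hp]

theorem and (hw : 2 ≤ w) {Q : (ℕ → Bool) → Prop} (hP : HasDepth w D d P)
    (hQ : HasDepth w D d Q) : HasDepth w D (d + 1) (fun x => P x ∧ Q x) := by
  refine (forall_mem (by omega) Finset.univ (P := fun b : Bool => if b then P else Q)
    (fun b _ => by cases b <;> simpa) ?_).congr fun x => ?_
  · calc Finset.card (Finset.univ : Finset Bool) < 2 ^ 2 := by simp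
      _ ≤ 2 ^ w := Nat.pow_le_pow_right two_pos hw
  · simp [and_comm]

end HasDepth

/-! ### The encoding of a set, in terms of consecutive elements -/

/-- The largest element of `S` below `a`, or `0` if there is none. -/
def predIn (S : Finset ℕ) (a : ℕ) : ℕ := (S.filter (· < a)).sup id

/-- `a` is an element of `S` and `b` is the element before it, or `0` if `a` is the first. -/
def Consecutive (S : Finset ℕ) (b a : ℕ) : Prop :=
  (b = 0 ∨ b ∈ S) ∧ b < a ∧ a ∈ S ∧ ∀ c ∈ Finset.Ioo b a, c ∉ S

theorem consecutive_iff {S : Finset ℕ} {b a : ℕ} (ha : 0 < a) :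
    Consecutive S b a ↔ a ∈ S ∧ b = predIn S a := by
  have le_predIn {c : ℕ} (hc : c ∈ S) (hca : c < a) : c ≤ predIn S a :=
    Finset.le_sup (f := id) (Finset.mem_filter.2 ⟨hc, hca⟩)
  constructor
  · rintro ⟨hb, hba, haS, hgap⟩
    refine ⟨haS, le_antisymm ?_ (Finset.sup_le fun c hc => ?_)⟩
    · rcases hb with rfl | hb
      · exact Nat.zero_le _
      · exact le_predIn hb hba
    · rw [Finset.mem_filter] at hc
      by_contra! hbc
      exact hgap c (Finset.mem_Ioo.2 ⟨hbc, hc.2⟩) hc.1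
  · rintro ⟨haS, rfl⟩
    refine ⟨?_, ?_, haS, fun c hc hcS => ?_⟩
    · rcases (S.filter (· < a)).eq_empty_or_nonempty with h | h
      · exact .inl (by simp [predIn, h])
      · obtain ⟨c, hc, hsup⟩ := Finset.exists_mem_eq_sup _ h id
        exact .inr (by rw [predIn, hsup]; exact (Finset.mem_filter.1 hc).1)
    · exact (Finset.sup_lt_iff (by simpa using ha)).2 fun c hc => (Finset.mem_filter.1 hc).2
    · rw [Finset.mem_Ioo] at hc
      exact hc.1.not_ge (le_predIn hcS hc.2)

theorem sort_insert_max {S : Finset ℕ} {m : ℕ} (h : ∀ y ∈ S, y < m) :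
    (insert m S).sort (· ≤ ·) = S.sort (· ≤ ·) ++ [m] := by
  refine List.Perm.eq_of_pairwise' (r := (· ≤ ·)) (Finset.pairwise_sort _ _) ?_ ?_
  · refine List.pairwise_append.2 ⟨Finset.pairwise_sort _ _, by simp, fun a ha b hb => ?_⟩
    exact List.mem_singleton.1 hb ▸ (h a (by simpa using ha)).le
  · refine (List.perm_ext_iff_of_nodup (Finset.sort_nodup _ _) ?_).2 fun y => by simp [or_comm]
    refine List.nodup_append.2 ⟨Finset.sort_nodup _ _, by simp, fun a ha b hb => ?_⟩
    exact List.mem_singleton.1 hb ▸ (h a (by simpa using ha)).ne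

theorem shifts_append_singleton (p m : ℕ) (l : List ℕ) :
    shifts p (l ++ [m]) = shifts p l ++ [m - l.getLastD p] := by
  induction l generalizing p with
  | nil => rfl
  | cons y l ih =>
    rw [List.cons_append, shifts, ih, shifts, List.getLastD_cons]
    rfl

theorem getLastD_sort (S : Finset ℕ) : (S.sort (· ≤ ·)).getLastD 0 = S.sup id := by
  induction S using Finset.induction_on_max with
  | empty => simp
  | insert m S h _ =>
    have : S.sup id ≤ m := Finset.sup_le fun y hy => (h y hy).le
    rw [sort_insert_max h, Finset.sup_insert]
    simpa using this

theorem encSet_insert_max {S : Finset ℕ} {m : ℕ} (h : ∀ y ∈ S, y < m) :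
    encSet (insert m S) = encSet S ++ encNat (m - S.sup id) := by
  rw [encSet, sort_insert_max h, shifts_append_singleton, List.flatMap_append, getLastD_sort]
  simp [encSet]

theorem encSet_filter_succ (S : Finset ℕ) (a : ℕ) : encSet (S.filter (· ≤ a + 1)) =
    encSet (S.filter (· ≤ a)) ++
      if a + 1 ∈ S then encNat (a + 1 - predIn S (a + 1)) else [] := by
  split_ifs with h
  · have hfilter : S.filter (· ≤ a + 1) = insert (a + 1) (S.filter (· ≤ a)) := by ext; grind
    rw [hfilter, encSet_insert_max fun y hy => Nat.lt_succ_of_le (Finset.mem_filter.1 hy).2]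
    simp only [predIn, Nat.lt_succ_iff]
  · have hfilter : S.filter (· ≤ a + 1) = S.filter (· ≤ a) := by ext; grind
    rw [hfilter, List.append_nil]

theorem encSet_filter_zero {S : Finset ℕ} (hS : 0 ∉ S) : encSet (S.filter (· ≤ 0)) = [] := by
  have : S.filter (· ≤ 0) = ∅ := by ext; grind
  rw [this, encSet, Finset.sort_empty, shifts, List.flatMap_nil]

theorem length_encSet_filter {S : Finset ℕ} (hS : 0 ∉ S) (a : ℕ) :
    (encSet (S.filter (· ≤ a))).length =
      ∑ b ∈ Finset.range a,
        if b + 1 ∈ S then (encNat (b + 1 - predIn S (b + 1))).length else 0 := by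
  induction a with
  | zero => rw [encSet_filter_zero hS, List.length_nil, Finset.sum_range_zero]
  | succ a ih =>
    rw [encSet_filter_succ, List.length_append, ih, Finset.sum_range_succ]
    split_ifs <;> rfl

theorem getElem?_encSet_filter {S : Finset ℕ} (hS : 0 ∉ S) (U p : ℕ) (t : Fin 3) :
    (encSet (S.filter (· ≤ U)))[p]? = some t ↔ ∃ a < U, a + 1 ∈ S ∧
      (encSet (S.filter (· ≤ a))).length ≤ p ∧
      (encNat (a + 1 - predIn S (a + 1)))[p - (encSet (S.filter (· ≤ a))).length]? = some t := by
  induction U with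
  | zero => rw [encSet_filter_zero hS]; simp
  | succ U ih =>
    simp only [Nat.lt_succ_iff_lt_or_eq, or_and_right, exists_or, exists_eq_left]
    rw [← ih, encSet_filter_succ]
    rcases lt_or_ge p (encSet (S.filter (· ≤ U))).length with h | h
    · simp [List.getElem?_append_left h, h.not_ge]
    · rw [List.getElem?_append_right h, List.getElem?_eq_none (l := encSet (S.filter (· ≤ U))) h]
      split_ifs with hU <;> simp [hU, h]

open Classical in
theorem length_encSet_filter_eq_sum_consecutive {S : Finset ℕ} (hS : 0 ∉ S) (a : ℕ) :
    (encSet (S.filter (· ≤ a))).length = ∑ i ∈ Finset.range a ×ˢ Finset.range a,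
      if Consecutive S i.2 (i.1 + 1) then (encNat (i.1 + 1 - i.2)).length else 0 := by
  rw [length_encSet_filter hS, Finset.sum_product]
  refine Finset.sum_congr rfl fun b hb => ?_
  simp only [consecutive_iff b.succ_pos]
  split_ifs with h
  · have hpred : predIn S (b + 1) < b + 1 := ((consecutive_iff b.succ_pos).2 ⟨h, rfl⟩).2.1
    simp only [h, true_and]
    rw [Finset.sum_ite_eq', if_pos (Finset.mem_range.2 (by grind))]
  · simp only [h, false_and, if_false, Finset.sum_const_zero]

theorem getElem?_encSet_eq_some_iff {S : Finset ℕ} {U : ℕ} (hS : S ⊆ Finset.Icc 1 U) (p : ℕ)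
    (t : Fin 3) : (encSet S)[p]? = some t ↔ ∃ a b o, (a < U ∧ b < U ∧ o ≤ p) ∧
      (encNat (a + 1 - b))[p - o]? = some t ∧ Consecutive S b (a + 1) ∧
        (encSet (S.filter (· ≤ a))).length = o := by
  have hfilter : S.filter (· ≤ U) = S :=
    Finset.filter_true_of_mem fun a ha => (Finset.mem_Icc.1 (hS ha)).2
  conv_lhs => rw [← hfilter, getElem?_encSet_filter fun h => by simpa using hS h]
  refine exists_congr fun a => ⟨fun ⟨haU, haS, hle, hsymbol⟩ => ?_, ?_⟩
  · have hcons := (consecutive_iff a.succ_pos).2 ⟨haS, rfl⟩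
    have hlt : predIn S (a + 1) < a + 1 := hcons.2.1
    exact ⟨predIn S (a + 1), _, ⟨haU, by omega, hle⟩, hsymbol, hcons, rfl⟩
  · rintro ⟨b, o, ⟨haU, -, hle⟩, hsymbol, hcons, rfl⟩
    obtain ⟨haS, rfl⟩ := (consecutive_iff a.succ_pos).1 hcons
    exact ⟨haU, haS, hle, hsymbol⟩

theorem getElem?_encReg {t : Fin 3} (ht : t ≠ 0) {n p : ℕ} {S : Finset ℕ} :
    (encReg n S)[p]? = some t ↔ (encSet S)[p]? = some t := by
  rw [encReg, List.rightpad, List.getElem?_append]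
  split_ifs with h
  · rfl
  · rw [List.getElem?_eq_none (not_lt.1 h), List.getElem?_replicate]
    grind

/-! ### Decoding -/

theorem two_notMem_digits (d : ℕ) :
    (2 : Fin 3) ∉ d.bits.reverse.map fun b => if b then (1 : Fin 3) else 0 := by
  rw [List.mem_map]
  rintro ⟨_ | _, -, h⟩ <;> exact absurd h (by decide)

theorem length_encNat (d : ℕ) : (encNat d).length = d.size + 1 := by
  simp [encNat, Nat.size_eq_bits_len]

theorem length_encNat_pos (d : ℕ) : 0 < (encNat d).length := by
  rw [length_encNat]
  exact Nat.succ_pos _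

theorem length_encNat_le (d : ℕ) : (encNat d).length ≤ d + 1 := by
  rw [length_encNat, Nat.add_le_add_iff_right]
  exact Nat.size_le.2 Nat.lt_two_pow_self

theorem encNat_injective : Function.Injective encNat := by
  intro a b h
  have hbits : a.bits = b.bits := List.reverse_injective <|
    List.map_injective_iff.2 (by decide) (List.append_cancel_right_eq _ _ _ ▸ h)
  exact Nat.digits.injective 2 (by rw [Nat.digits_two_eq_bits, Nat.digits_two_eq_bits, hbits])

theorem getElem?_encNat_eq_two {d j : ℕ} :
    (encNat d)[j]? = some 2 ↔ j + 1 = (encNat d).length := by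
  rw [encNat, List.length_append, List.length_singleton, Nat.add_right_cancel_iff,
    List.getElem?_append]
  split_ifs with h
  · exact iff_of_false (fun hj => two_notMem_digits d (List.mem_of_getElem? hj)) h.ne
  · rw [List.getElem?_singleton]
    split_ifs <;> simp only [true_iff, false_iff] <;> omega

theorem encNat_prefix_iff {d d₀ : ℕ} {l : List (Fin 3)} :
    encNat d <+: encNat d₀ ++ l ↔ d = d₀ := by
  refine ⟨fun ⟨r, hr⟩ => ?_, fun h => h ▸ List.prefix_append _ _⟩
  have first_separator (e : ℕ) (l : List (Fin 3)) :
      (encNat e ++ l).idxOf 2 + 1 = (encNat e).length := by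
    rw [encNat, List.append_assoc, List.idxOf_append_of_notMem (two_notMem_digits e)]
    simp
  have hlen : (encNat d).length = (encNat d₀).length := by
    rw [← first_separator d r, hr, first_separator]
  exact encNat_injective (List.append_inj hr hlen).1

/-- The encoding of the number `d` begins at the position `p` of the string `l`, and the position
`p` is `0` or follows a separation character. -/
def TokenAt (l : List (Fin 3)) (p d : ℕ) : Prop :=
  (p = 0 ∨ l[p - 1]? = some 2) ∧ encNat d <+: l.drop p

theorem tokenAt_append_zero {l : List (Fin 3)} {d₀ d : ℕ} :
    TokenAt (encNat d₀ ++ l) 0 d ↔ d = d₀ := by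
  rw [TokenAt, List.drop_zero, encNat_prefix_iff]
  simp only [true_or, true_and]

theorem not_tokenAt_append {l : List (Fin 3)} {d₀ p d : ℕ} (hp : 0 < p)
    (hpd : p < (encNat d₀).length) : ¬TokenAt (encNat d₀ ++ l) p d := by
  rintro ⟨hp0 | hsep, -⟩
  · exact hp.ne' hp0
  · rw [List.getElem?_append_left (by omega), getElem?_encNat_eq_two] at hsep
    omega

theorem tokenAt_append_add {l : List (Fin 3)} {d₀ p d : ℕ} :
    TokenAt (encNat d₀ ++ l) ((encNat d₀).length + p) d ↔ TokenAt l p d := by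
  have hpos := length_encNat_pos d₀
  rw [TokenAt, TokenAt, List.drop_append, List.drop_eq_nil_of_le (by omega),
    Nat.add_sub_cancel_left, List.nil_append]
  refine and_congr_left' ?_
  rcases p.eq_zero_or_pos with rfl | hp
  · rw [add_zero, List.getElem?_append_left (by omega), getElem?_encNat_eq_two]
    simp only [true_or, iff_true]
    omega
  · rw [List.getElem?_append_right (by omega), Nat.add_sub_assoc hp, Nat.add_sub_cancel_left]
    simp only [hp.ne', false_or, or_iff_right_iff_imp]
    omega

theorem exists_separator_encNat_append {l : List (Fin 3)} {d : ℕ} {Q : ℕ → Prop} :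
    (∃ q, (encNat d ++ l)[q]? = some 2 ∧ Q (q + 1)) ↔
      Q (encNat d).length ∨ ∃ q, l[q]? = some 2 ∧ Q ((encNat d).length + (q + 1)) := by
  constructor
  · rintro ⟨q, hsep, hQ⟩
    rcases lt_or_ge q (encNat d).length with hq | hq
    · rw [List.getElem?_append_left hq, getElem?_encNat_eq_two] at hsep
      exact .inl (hsep ▸ hQ)
    · rw [List.getElem?_append_right hq] at hsep
      exact .inr ⟨_, hsep, by rwa [← add_assoc, Nat.add_sub_cancel' hq]⟩
  · rintro (hQ | ⟨q, hsep, hQ⟩)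
    · have hpos := length_encNat_pos d
      refine ⟨(encNat d).length - 1, ?_, by rwa [Nat.sub_add_cancel hpos]⟩
      rw [List.getElem?_append_left (by omega), getElem?_encNat_eq_two, Nat.sub_add_cancel hpos]
    · exact ⟨(encNat d).length + q, by rwa [List.getElem?_append_right (by omega),
        Nat.add_sub_cancel_left], hQ⟩

open Classical in
/-- The sum of the numbers up to `U` that are encoded in the first `k` symbols of `l`. -/
noncomputable def decodeSum (U : ℕ) (l : List (Fin 3)) (k : ℕ) : ℕ :=
  ∑ p ∈ Finset.range l.length, ∑ d ∈ Finset.Icc 1 U,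
    if p + (encNat d).length ≤ k ∧ TokenAt l p d then d else 0

open Classical in
/-- The set of positive integers up to `U` that is encoded in `l`: as `l` encodes differences, its
elements are the sums up to a separation character. -/
noncomputable def decodeSet (U : ℕ) (l : List (Fin 3)) : Finset ℕ :=
  (Finset.Icc 1 U).filter fun a =>
    ∃ q ∈ Finset.range l.length, l[q]? = some 2 ∧ decodeSum U l (q + 1) = a

theorem decodeSum_zero (U : ℕ) (l : List (Fin 3)) : decodeSum U l 0 = 0 := by
  refine Finset.sum_eq_zero fun p _ => Finset.sum_eq_zero fun d _ => if_neg ?_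
  have := length_encNat_pos d
  omega

theorem decodeSum_encNat_append {U d : ℕ} (hd : d ∈ Finset.Icc 1 U) (l : List (Fin 3)) (k : ℕ) :
    decodeSum U (encNat d ++ l) ((encNat d).length + k) = d + decodeSum U l k := by
  classical
  have hpos := length_encNat_pos d
  rw [decodeSum, decodeSum, List.length_append, Finset.sum_range_add]
  congr 1
  · rw [Finset.sum_eq_single_of_mem 0 (Finset.mem_range.2 hpos), Finset.sum_eq_single_of_mem d hd]
    · rw [if_pos ⟨by omega, tokenAt_append_zero.2 rfl⟩]
    · exact fun e _ hed => if_neg fun h => hed (tokenAt_append_zero.1 h.2)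
    · refine fun p hp hp0 => Finset.sum_eq_zero fun e _ => if_neg fun h => ?_
      exact not_tokenAt_append (Nat.pos_of_ne_zero hp0) (Finset.mem_range.1 hp) h.2
  · simp only [tokenAt_append_add, add_assoc, Nat.add_le_add_iff_left]

theorem exists_decodeSum_shifts_eq_iff {U a p : ℕ} {ys : List ℕ} {l : List (Fin 3)}
    (hys : (p :: ys).Pairwise (· < ·)) (hU : ∀ y ∈ ys, y ≤ U) (hl : 2 ∉ l) :
    (∃ q, ((shifts p ys).flatMap encNat ++ l)[q]? = some 2 ∧
      p + decodeSum U ((shifts p ys).flatMap encNat ++ l) (q + 1) = a) ↔ a ∈ ys := by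
  induction ys generalizing p with
  | nil =>
    simp only [shifts, List.flatMap_nil, List.nil_append, List.not_mem_nil, iff_false]
    exact fun ⟨q, hq, _⟩ => hl (List.mem_of_getElem? hq)
  | cons y ys ih =>
    rw [List.pairwise_cons] at hys
    rw [List.forall_mem_cons] at hU
    have hpy : p < y := hys.1 y List.mem_cons_self
    have hsum := decodeSum_encNat_append (U := U) (d := y - p) (Finset.mem_Icc.2 (by omega))
      ((shifts y ys).flatMap encNat ++ l)
    have hsum₀ := hsum 0
    rw [add_zero, decodeSum_zero, add_zero] at hsum₀
    simp only [shifts, List.flatMap_cons, List.append_assoc]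
    rw [exists_separator_encNat_append (Q := fun k => p + decodeSum U _ k = a), List.mem_cons,
      ← ih hys.2 hU.2]
    simp only [hsum, hsum₀, ← add_assoc p, Nat.add_sub_cancel' hpy.le, eq_comm (a := a)]

theorem decodeSet_encSet_append {U : ℕ} {S : Finset ℕ} (hS : S ⊆ Finset.Icc 1 U)
    {l : List (Fin 3)} (hl : 2 ∉ l) : decodeSet U (encSet S ++ l) = S := by
  have hpos (y : ℕ) (hy : y ∈ S.sort (· ≤ ·)) := Finset.mem_Icc.1 (hS ((Finset.mem_sort _).1 hy))
  ext a
  have hsums := exists_decodeSum_shifts_eq_iff (a := a) (p := 0)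
    (List.pairwise_cons.2 ⟨fun y hy => (hpos y hy).1, (Finset.sortedLT_sort S).pairwise⟩)
    (fun y hy => (hpos y hy).2) hl
  simp only [zero_add, Finset.mem_sort] at hsums
  rw [decodeSet, Finset.mem_filter, encSet, ← hsums]
  refine ⟨fun ⟨_, q, _, hq⟩ => ⟨q, hq⟩, fun ⟨q, hq⟩ => ⟨hS (hsums.1 ⟨q, hq⟩), q, ?_, hq⟩⟩
  exact Finset.mem_range.2 (List.getElem?_eq_some_iff.1 hq.1).1

theorem decodeSet_subset (U : ℕ) (l : List (Fin 3)) : decodeSet U l ⊆ Finset.Icc 1 U :=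
  Finset.filter_subset _ _

/-! ### Registers of trits -/

/-- The trit `p` of the register that begins at the wire `b`. The fourth pattern `11` of two bits
is read as `2`. -/
def readTrit (b : ℕ) (x : ℕ → Bool) (p : ℕ) : Fin 3 :=
  if x (b + 2 * p + 1) then 2 else if x (b + 2 * p) then 1 else 0

/-- The content of the register of `T` trits that begins at the wire `b`. -/
def readTrits (b T : ℕ) (x : ℕ → Bool) : List (Fin 3) := (List.range T).map (readTrit b x)

/-- The wires of the register of `T` trits that begins at the wire `b`. -/
abbrev regWires (b T : ℕ) : Set ℕ := Set.Ico b (b + 2 * T)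

/-- The register of `T` trits that begins at the wire `b` contains the string `l`, filled up with
zeros or cut off. -/
def Holds (b T : ℕ) (l : List (Fin 3)) (x : ℕ → Bool) : Prop :=
  ∀ i < 2 * T, x (b + i) = (l.flatMap tritBits).getD i false

open Classical in
/-- The union of the sets of positive integers up to `U` that are encoded in the registers of a
list. A register is given by its first wire and its number of trits. -/
noncomputable def decodeRegs (U : ℕ) (regs : List (ℕ × ℕ)) (x : ℕ → Bool) : Finset ℕ :=
  regs.toFinset.biUnion fun g => decodeSet U (readTrits g.1 g.2 x)

theorem length_readTrits (b T : ℕ) (x : ℕ → Bool) : (readTrits b T x).length = T := by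
  rw [readTrits, List.length_map, List.length_range]

theorem getElem?_readTrits {b T p : ℕ} {x : ℕ → Bool} {t : Fin 3} :
    (readTrits b T x)[p]? = some t ↔ p < T ∧ readTrit b x p = t := by
  simp [readTrits, List.getElem?_eq_some_iff]

theorem readTrits_congr {b T : ℕ} {x y : ℕ → Bool} (h : ∀ i ∈ regWires b T, x i = y i) :
    readTrits b T x = readTrits b T y := by
  refine List.map_congr_left fun p hp => ?_
  rw [List.mem_range] at hp
  rw [readTrit, readTrit, h _ ⟨by omega, by omega⟩, h _ ⟨by omega, by omega⟩]

theorem getD_flatMap_tritBits (l : List (Fin 3)) (p : ℕ) :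
    (l.flatMap tritBits).getD (2 * p) false = decide (l[p]? = some 1) ∧
      (l.flatMap tritBits).getD (2 * p + 1) false = decide (l[p]? = some 2) := by
  induction l generalizing p with
  | nil => simp
  | cons t l ih =>
    cases p with
    | zero => simp [tritBits]
    | succ p =>
      rw [List.flatMap_cons]
      simpa [tritBits, Nat.mul_add] using ih p

theorem Holds.readTrit_eq {b T : ℕ} {l : List (Fin 3)} {x : ℕ → Bool} (h : Holds b T l x)
    {p : ℕ} (hp : p < T) (hpl : p < l.length) : readTrit b x p = l[p] := by
  have h₁ := h (2 * p) (by omega)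
  have h₂ := h (2 * p + 1) (by omega)
  rw [(getD_flatMap_tritBits l p).1] at h₁
  rw [(getD_flatMap_tritBits l p).2, ← add_assoc] at h₂
  rw [readTrit, h₁, h₂, List.getElem?_eq_getElem hpl]
  generalize l[p] = t
  fin_cases t <;> decide

theorem Holds.readTrits_eq {b T : ℕ} {l : List (Fin 3)} {x : ℕ → Bool} (h : Holds b T l x)
    (hl : l.length = T) : readTrits b T x = l := by
  refine List.ext_getElem (by rw [length_readTrits, hl]) fun p hp hpl => ?_
  simp only [readTrits, List.getElem_map, List.getElem_range]
  exact h.readTrit_eq (by omega) hpl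

theorem decodeRegs_congr {U : ℕ} {regs : List (ℕ × ℕ)} {x y : ℕ → Bool}
    (h : ∀ g ∈ regs, ∀ i ∈ regWires g.1 g.2, x i = y i) :
    decodeRegs U regs x = decodeRegs U regs y := by
  refine Finset.biUnion_congr rfl fun g hg => ?_
  rw [readTrits_congr (h g (List.mem_toFinset.1 hg))]

theorem decodeRegs_append_singleton (U : ℕ) (regs : List (ℕ × ℕ)) (b T : ℕ) (x : ℕ → Bool) :
    decodeRegs U (regs ++ [(b, T)]) x =
      decodeRegs U regs x ∪ decodeSet U (readTrits b T x) := by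
  ext a
  simp [decodeRegs, or_comm]

theorem decodeRegs_subset (U : ℕ) (regs : List (ℕ × ℕ)) (x : ℕ → Bool) :
    decodeRegs U regs x ⊆ Finset.Icc 1 U :=
  Finset.biUnion_subset.2 fun _ _ => decodeSet_subset U _

namespace HasDepth

variable {w d : ℕ} {D : Set ℕ}

theorem readTrit_eq (hw : 2 ≤ w) {b T p : ℕ} (hD : regWires b T ⊆ D) (hp : p < T) (t : Fin 3) :
    HasDepth w D 2 (fun x => readTrit b x p = t) := by
  have low : HasDepth w D 0 (fun x => x (b + 2 * p) = true) :=
    wire (hD ⟨by omega, by omega⟩)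
  have high : HasDepth w D 0 (fun x => x (b + 2 * p + 1) = true) :=
    wire (hD ⟨by omega, by omega⟩)
  have hw₀ : 0 < w := by omega
  fin_cases t
  · refine ((high.not hw₀).and hw (low.not hw₀)).congr fun x => ?_
    unfold readTrit
    split_ifs <;> simp [*]
  · refine ((high.not hw₀).and hw (low.mono zero_le_one)).congr fun x => ?_
    unfold readTrit
    split_ifs <;> simp [*]
  · refine (high.mono (Nat.zero_le 2)).congr fun x => ?_
    unfold readTrit
    split_ifs <;> simp [*]

theorem getElem?_readTrits_eq (hw : 2 ≤ w) {b T : ℕ} (hD : regWires b T ⊆ D) (p : ℕ)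
    (t : Fin 3) : HasDepth w D 2 (fun x => (readTrits b T x)[p]? = some t) :=
  (const_and fun hp : p < T => readTrit_eq hw hD hp t).congr fun _ => getElem?_readTrits.symm

theorem prefix_drop_readTrits (hw : 2 ≤ w) {b T : ℕ} (hD : regWires b T ⊆ D)
    {l : List (Fin 3)} (hl : l.length < 2 ^ w) (p : ℕ) :
    HasDepth w D 3 (fun x => l <+: (readTrits b T x).drop p) := by
  refine (forall_mem (by omega) (Finset.univ : Finset (Fin l.length))
    (fun j _ => getElem?_readTrits_eq hw hD (p + j) l[j]) (by simpa using hl)).congr fun x => ?_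
  simp only [List.prefix_iff_getElem?, List.getElem?_drop, Finset.mem_univ, forall_true_left,
    Fin.forall_iff, Fin.getElem_fin]

theorem tokenAt_readTrits (hw : 2 ≤ w) {b T : ℕ} (hD : regWires b T ⊆ D) {e : ℕ}
    (he : (encNat e).length < 2 ^ w) (p : ℕ) :
    HasDepth w D 4 (fun x => TokenAt (readTrits b T x) p e) := by
  refine HasDepth.and hw ?_ (prefix_drop_readTrits hw hD he p)
  by_cases hp : p = 0
  · exact ((const (d := 0) (by omega) True).mono (by omega)).congr fun x => by
      simp only [hp, true_or]
  · exact ((getElem?_readTrits_eq hw hD (p - 1) 2).mono (by omega)).congr fun x => by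
      simp only [hp, false_or]

theorem decodeSum_readTrits_eq (hw : 2 ≤ w) {b T U : ℕ} (hD : regWires b T ⊆ D)
    (hcap : (U + T + 2) ^ 3 < 2 ^ w) (k a : ℕ) :
    HasDepth w D 5 (fun x => decodeSum U (readTrits b T x) k = a) := by
  classical
  have hU : U + T + 2 < 2 ^ w := (Nat.le_self_pow (by norm_num) _).trans_lt hcap
  refine (sum_eq (by omega) (Finset.range T ×ˢ Finset.Icc 1 U) (fun i => i.2) (fun i hi =>
    const_and (p := i.1 + (encNat i.2).length ≤ k) fun _ =>
      tokenAt_readTrits hw hD (e := i.2) ?_ i.1) ?_ a).congr fun x => ?_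
  · have := length_encNat_le i.2
    simp only [Finset.mem_product, Finset.mem_Icc] at hi
    omega
  · calc ∑ i ∈ Finset.range T ×ˢ Finset.Icc 1 U, i.2
        ≤ ∑ _i ∈ Finset.range T ×ˢ Finset.Icc 1 U, U := Finset.sum_le_sum fun i hi =>
          (Finset.mem_Icc.1 (Finset.mem_product.1 hi).2).2
      _ = T * U * U := by simp
      _ ≤ (U + T + 2) * (U + T + 2) * (U + T + 2) := by gcongr <;> omega
      _ = (U + T + 2) ^ 3 := by ring
      _ < 2 ^ w := hcap
  · rw [Finset.sum_product, decodeSum, length_readTrits]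
    congr!

theorem mem_decodeSet (hw : 2 ≤ w) {b T U : ℕ} (hD : regWires b T ⊆ D)
    (hcap : (U + T + 2) ^ 3 < 2 ^ w) (a : ℕ) :
    HasDepth w D 8 (fun x => a ∈ decodeSet U (readTrits b T x)) := by
  have hT : U + T + 2 < 2 ^ w := (Nat.le_self_pow (by norm_num) _).trans_lt hcap
  refine (const_and (p := a ∈ Finset.Icc 1 U) fun _ => exists_mem (by omega) (Finset.range T)
    (fun q _ => ((getElem?_readTrits_eq hw hD q 2).mono (by omega)).and hw
      (decodeSum_readTrits_eq hw hD hcap (q + 1) a)) ?_).congr fun x => ?_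
  · rw [Finset.card_range]
    omega
  · rw [decodeSet, Finset.mem_filter, length_readTrits]

theorem mem_decodeRegs (hw : 2 ≤ w) {T U : ℕ} {regs : List (ℕ × ℕ)}
    (hD : ∀ g ∈ regs, regWires g.1 g.2 ⊆ D) (hT : ∀ g ∈ regs, g.2 ≤ T)
    (hcap : (U + T + 2) ^ 3 < 2 ^ w) (hlen : regs.length < 2 ^ w) (a : ℕ) :
    HasDepth w D 10 (fun x => a ∈ decodeRegs U regs x) := by
  classical
  refine (exists_mem (by omega) regs.toFinset
    (P := fun g x => a ∈ decodeSet U (readTrits g.1 g.2 x)) (fun g hg => ?_)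
    (regs.toFinset_card_le.trans_lt hlen)).congr fun x => ?_
  · rw [List.mem_toFinset] at hg
    refine mem_decodeSet hw (hD g hg) (lt_of_le_of_lt ?_ hcap) a
    gcongr
    exact hT g hg
  · rw [decodeRegs, Finset.mem_biUnion]

/-! ### Writing the encoding of a set -/

theorem consecutive (hw : 2 ≤ w) {S : (ℕ → Bool) → Finset ℕ}
    (hS : ∀ a, HasDepth w D d (fun x => a ∈ S x)) {b a : ℕ} (ha : a < 2 ^ w) :
    HasDepth w D (d + 4) (fun x => Consecutive (S x) b a) := by
  have hw₀ : 0 < w := by omega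
  have hb : HasDepth w D (d + 3) (fun x => b = 0 ∨ b ∈ S x) := by
    by_cases hb : b = 0
    · exact ((const (d := 0) hw₀ True).mono (by omega)).congr fun x => by simp only [hb, true_or]
    · exact ((hS b).mono (by omega)).congr fun x => by simp only [hb, false_or]
  refine hb.and hw (const_and fun _ => ((hS a).mono (by omega)).and hw
    (forall_mem hw₀ _ (fun c _ => (hS c).not hw₀) ?_))
  rw [Nat.card_Ioo]
  omega

theorem length_encSet_filter_eq (hw : 2 ≤ w) {S : (ℕ → Bool) → Finset ℕ}
    (hS : ∀ a, HasDepth w D d (fun x => a ∈ S x)) (hS₀ : ∀ x, 0 ∉ S x) {a : ℕ}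
    (ha : (a + 2) ^ 3 < 2 ^ w) (o : ℕ) :
    HasDepth w D (d + 5) (fun x => (encSet ((S x).filter (· ≤ a))).length = o) := by
  classical
  have ha' : a + 2 < 2 ^ w := (Nat.le_self_pow (by norm_num) _).trans_lt ha
  refine (sum_eq (by omega) (Finset.range a ×ˢ Finset.range a)
    (fun i => (encNat (i.1 + 1 - i.2)).length)
    (P := fun i x => Consecutive (S x) i.2 (i.1 + 1)) (fun i hi => ?_) ?_ o).congr fun x => ?_
  · simp only [Finset.mem_product, Finset.mem_range] at hi
    exact consecutive hw hS (by omega)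
  · calc ∑ i ∈ Finset.range a ×ˢ Finset.range a, (encNat (i.1 + 1 - i.2)).length
        ≤ ∑ _i ∈ Finset.range a ×ˢ Finset.range a, (a + 2) := Finset.sum_le_sum fun i hi => by
          have := length_encNat_le (i.1 + 1 - i.2)
          simp only [Finset.mem_product, Finset.mem_range] at hi
          omega
      _ = a * a * (a + 2) := by simp
      _ ≤ (a + 2) * (a + 2) * (a + 2) := by gcongr <;> omega
      _ = (a + 2) ^ 3 := by ring
      _ < 2 ^ w := ha
  · rw [length_encSet_filter_eq_sum_consecutive (hS₀ x)]

theorem getElem?_encSet_eq (hw : 2 ≤ w) {S : (ℕ → Bool) → Finset ℕ} {U p : ℕ}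
    (hS : ∀ a, HasDepth w D d (fun x => a ∈ S x)) (hSU : ∀ x, S x ⊆ Finset.Icc 1 U)
    (hcap : (U + p + 2) ^ 3 < 2 ^ w) (t : Fin 3) :
    HasDepth w D (d + 8) (fun x => (encSet (S x))[p]? = some t) := by
  have hcap' : U + p + 2 < 2 ^ w := (Nat.le_self_pow (by norm_num) _).trans_lt hcap
  have hS₀ (x : ℕ → Bool) : 0 ∉ S x := fun h => by simpa using hSU x h
  refine (exists_mem (by omega)
    (Finset.range U ×ˢ Finset.range U ×ˢ Finset.range (p + 1))
    (P := fun i x => (encNat (i.1 + 1 - i.2.1))[p - i.2.2]? = some t ∧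
      (Consecutive (S x) i.2.1 (i.1 + 1) ∧
        (encSet ((S x).filter (· ≤ i.1))).length = i.2.2)) (fun i hi => ?_) ?_).congr fun x => ?_
  · simp only [Finset.mem_product, Finset.mem_range] at hi
    have ha : (i.1 + 2) ^ 3 < 2 ^ w := lt_of_le_of_lt (by gcongr; omega) hcap
    exact const_and fun _ => ((consecutive hw hS (by omega)).mono (by omega)).and hw
      (length_encSet_filter_eq hw hS hS₀ ha i.2.2)
  · simp only [Finset.card_product, Finset.card_range]
    calc U * (U * (p + 1)) ≤ (U + p + 2) * ((U + p + 2) * (U + p + 2)) := by gcongr <;> omega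
      _ = (U + p + 2) ^ 3 := by ring
      _ < 2 ^ w := hcap
  · rw [getElem?_encSet_eq_some_iff (hSU x)]
    simp only [Prod.exists, Finset.mem_product, Finset.mem_range, Nat.lt_succ_iff]

theorem getD_encReg (hw : 2 ≤ w) {S : (ℕ → Bool) → Finset ℕ} {U i : ℕ} (n : ℕ)
    (hS : ∀ a, HasDepth w D d (fun x => a ∈ S x)) (hSU : ∀ x, S x ⊆ Finset.Icc 1 U)
    (hcap : (U + i / 2 + 2) ^ 3 < 2 ^ w) :
    HasDepth w D (d + 8)
      (fun x => ((encReg n (S x)).flatMap tritBits).getD i false = true) := by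
  obtain ⟨p, rfl | rfl⟩ := Nat.even_or_odd' i
  · rw [Nat.mul_div_cancel_left p two_pos] at hcap
    refine (getElem?_encSet_eq hw hS hSU hcap 1).congr fun x => ?_
    rw [(getD_flatMap_tritBits _ p).1, decide_eq_true_eq, getElem?_encReg (by decide)]
  · rw [Nat.mul_add_div two_pos, Nat.div_eq_of_lt one_lt_two, add_zero] at hcap
    refine (getElem?_encSet_eq hw hS hSU hcap 2).congr fun x => ?_
    rw [(getD_flatMap_tritBits _ p).2, decide_eq_true_eq, getElem?_encReg (by decide)]

end HasDepth

/-! ### Selecting a variable of a clause -/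

theorem find?_eq_some_iff_idxOf {α : Type*} [DecidableEq α] {p : α → Bool} {l : List α} {a : α} :
    l.find? p = some a ↔ a ∈ l ∧ p a = true ∧ ∀ b ∈ l, l.idxOf b < l.idxOf a → p b = false := by
  induction l with
  | nil => simp
  | cons c l ih =>
    by_cases hc : p c = true
    · rw [List.find?_cons_of_pos hc, Option.some.injEq]
      refine ⟨?_, fun ⟨_, _, h⟩ => ?_⟩
      · rintro rfl
        exact ⟨List.mem_cons_self, hc, fun b _ hb => by simp at hb⟩
      · by_contra hca
        simpa [hc, List.idxOf_cons_ne _ hca] using h c List.mem_cons_self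
    · rw [List.find?_cons_of_neg hc, ih]
      have hne {b : α} (hb : p b = true) : c ≠ b := fun h => hc (h ▸ hb)
      have hcons : p a = true → ((∀ b ∈ c :: l, (c :: l).idxOf b < (c :: l).idxOf a →
          p b = false) ↔ ∀ b ∈ l, l.idxOf b < l.idxOf a → p b = false) := by
        refine fun ha => ⟨fun h b hb hlt => ?_, fun h b hb hlt => ?_⟩ <;>
          by_contra hpb <;> rw [Bool.not_eq_false] at hpb
        · refine absurd (h b (List.mem_cons_of_mem _ hb) ?_) (by simp [hpb])
          rwa [List.idxOf_cons_ne _ (hne ha), List.idxOf_cons_ne _ (hne hpb), Nat.succ_lt_succ_iff]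
        · rw [List.idxOf_cons_ne _ (hne ha), List.idxOf_cons_ne _ (hne hpb),
            Nat.succ_lt_succ_iff] at hlt
          exact absurd (h b (List.mem_of_ne_of_mem (hne hpb).symm hb) hlt) (by simp [hpb])
      refine ⟨fun ⟨ha, hpa, h⟩ => ⟨List.mem_cons_of_mem _ ha, hpa, (hcons hpa).2 h⟩,
        fun ⟨ha, hpa, h⟩ => ⟨List.mem_of_ne_of_mem (hne hpa).symm ha, hpa, (hcons hpa).1 h⟩⟩

theorem getElem?_eq_some_iff_countP_lt {α : Type*} [LinearOrder α] {l : List α}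
    (h : l.Pairwise (· < ·)) {c : ℕ} {a : α} :
    l[c]? = some a ↔ a ∈ l ∧ l.countP (fun b => decide (b < a)) = c := by
  induction l generalizing c with
  | nil => simp
  | cons b l ih =>
    obtain ⟨hb, hl⟩ := List.pairwise_cons.1 h
    have hcount : l.countP (fun e => decide (e < b)) = 0 :=
      List.countP_eq_zero.2 fun e he => by simpa using (hb e he).le
    rw [List.countP_cons, List.mem_cons]
    rcases eq_or_ne a b with rfl | hab
    · have hal : a ∉ l := fun ha => (hb a ha).false
      cases c <;> simp [hcount, ih hl, hal]
    · cases c with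
      | zero => simpa [hab, hab.symm] using fun ha _ => hb a ha
      | succ c =>
        simp only [List.getElem?_cons_succ, ih hl, hab, false_or]
        exact and_congr_right fun ha => by simp [hb a ha]

theorem getElem?_sort_eq_some_iff {α : Type*} [LinearOrder α] {S : Finset α} {c : ℕ} {a : α} :
    (S.sort (· ≤ ·))[c]? = some a ↔ a ∈ S ∧ (S.filter (· < a)).card = c := by
  rw [getElem?_eq_some_iff_countP_lt (Finset.sortedLT_sort S).pairwise, Finset.mem_sort]
  refine and_congr_right fun _ => Eq.congr_left ?_
  rw [List.countP_eq_length_filter, ← Multiset.coe_card, ← Multiset.filter_coe, Finset.sort_eq]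
  rfl

/-- The index of the variable that the choice `c` selects in the first clause that `x(V)` does not
satisfy, or `none` where `nextVar` resorts to a dummy variable. -/
def selected {n : ℕ} (F : Formula n) (V : Finset ℕ) (c : ℕ) : Option ℕ :=
  (F.find? fun C => !C.sat (assignment n V)).bind fun C => ((C.vars \ V).sort (· ≤ ·))[c]?

theorem nextVar_eq_getD_selected {n : ℕ} (F : Formula n) (V : Finset ℕ) (i : ℕ) (c : Fin 3) :
    nextVar F V i c = (selected F V c).getD (n + i) := by
  unfold nextVar selected
  cases F.find? fun C => !C.sat (assignment n V) with
  | none => rfl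
  | some C => exact List.getD_eq_getElem?_getD

theorem selected_eq_some_iff {n : ℕ} [DecidableEq (Clause n)] {F : Formula n} {V : Finset ℕ}
    {c a : ℕ} : selected F V c = some a ↔ ∃ C ∈ F.toFinset, a ∈ C.vars ∧
      ((C.sat (assignment n V) ≠ true ∧
        ∀ C' ∈ F.toFinset.filter (fun C' => F.idxOf C' < F.idxOf C),
          C'.sat (assignment n V) = true) ∧
      a ∉ V ∧ ((C.vars.filter (· < a)).filter (· ∉ V)).card = c) := by
  rw [selected, Option.bind_eq_some_iff]
  refine exists_congr fun C => ?_
  have hfilter : (C.vars \ V).filter (· < a) = (C.vars.filter (· < a)).filter (· ∉ V) := by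
    rw [← Finset.filter_notMem_eq_sdiff, Finset.filter_comm]
  rw [find?_eq_some_iff_idxOf, getElem?_sort_eq_some_iff, hfilter]
  simp only [List.mem_toFinset, Finset.mem_filter, Finset.mem_sdiff, Bool.not_eq_true',
    Bool.not_eq_false', and_imp, ne_eq, Bool.not_eq_true]
  tauto

theorem mem_Icc_of_selected_eq_some {n : ℕ} {F : Formula n} {V : Finset ℕ} {c a : ℕ}
    (h : selected F V c = some a) : a ∈ Finset.Icc 1 n := by
  classical
  obtain ⟨C, -, haC, -⟩ := selected_eq_some_iff.1 h
  obtain ⟨p, -, rfl⟩ := Finset.mem_image.1 haC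
  exact Finset.mem_Icc.2 ⟨Nat.le_add_left 1 _, p.1.isLt⟩

theorem nextVar_eq_iff {n : ℕ} {F : Formula n} {V : Finset ℕ} {i : ℕ} (hi : 0 < i) (c : Fin 3)
    (a : ℕ) : nextVar F V i c = a ↔
      if a = n + i then ∀ b ∈ Finset.Icc 1 n, selected F V c ≠ some b
      else selected F V c = some a := by
  rw [nextVar_eq_getD_selected]
  cases hb : selected F V c with
  | none => split_ifs with ha <;> simp [ha, eq_comm]
  | some b =>
    have hbn := mem_Icc_of_selected_eq_some hb
    rw [Option.getD_some]
    split_ifs with ha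
    · refine iff_of_false ?_ fun h => h b hbn rfl
      rw [Finset.mem_Icc] at hbn
      omega
    · rw [Option.some.injEq]

theorem card_clauses_le {n : ℕ} (s : Finset (Clause n)) : s.card ≤ 4 * (2 * n) ^ 3 + 1 := by
  classical
  rcases Nat.eq_zero_or_pos n with rfl | hn
  · refine (Finset.card_le_one.2 fun ⟨l, _⟩ _ ⟨l', _⟩ _ => ?_).trans (by omega)
    obtain rfl := Subsingleton.elim l l'
    rfl
  have hinj : Function.Injective (Clause.lits (n := n)) := by
    rintro ⟨l, _⟩ ⟨l', _⟩ rfl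
    rfl
  have hsub : s.image Clause.lits ⊆ (Finset.range 4).biUnion fun j =>
      Finset.powersetCard j (Finset.univ : Finset (Fin n × Bool)) := by
    intro l hl
    obtain ⟨C, -, rfl⟩ := Finset.mem_image.1 hl
    simp only [Finset.mem_biUnion, Finset.mem_range, Finset.mem_powersetCard_univ]
    exact ⟨_, Nat.lt_succ_of_le C.card_le, rfl⟩
  have hterm : ∀ j ∈ Finset.range 4,
      (Finset.powersetCard j (Finset.univ : Finset (Fin n × Bool))).card ≤ (2 * n) ^ 3 := by
    intro j hj
    rw [Finset.mem_range] at hj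
    rw [Finset.card_powersetCard, Finset.card_univ, Fintype.card_prod, Fintype.card_fin,
      Fintype.card_bool, mul_comm n 2]
    exact (Nat.choose_le_pow _ _).trans (Nat.pow_le_pow_right (by omega) (by omega))
  calc s.card = (s.image Clause.lits).card := (Finset.card_image_of_injective s hinj).symm
    _ ≤ _ := Finset.card_le_card hsub
    _ ≤ ∑ j ∈ Finset.range 4, _ := Finset.card_biUnion_le
    _ ≤ 4 * (2 * n) ^ 3 := by simpa using Finset.sum_le_card_nsmul _ _ _ hterm
    _ ≤ 4 * (2 * n) ^ 3 + 1 := Nat.le_succ _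

namespace HasDepth

variable {w d n : ℕ} {D : Set ℕ} {V : (ℕ → Bool) → Finset ℕ}

theorem sat (hw : 2 ≤ w) (hV : ∀ a, HasDepth w D d (fun x => a ∈ V x)) (C : Clause n) :
    HasDepth w D (d + 3) (fun x => C.sat (assignment n (V x)) = true) := by
  have hw' : 0 < w := by omega
  have hcard : C.lits.card < 2 ^ w := C.card_le.trans_lt
    (calc 3 < 2 ^ 2 := by norm_num
      _ ≤ 2 ^ w := Nat.pow_le_pow_right two_pos hw)
  refine (exists_mem hw' C.lits (P := fun p x => assignment n (V x) p.1 = p.2)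
    (fun ⟨a, b⟩ _ => ?_) hcard).congr fun x => by rw [Clause.sat, decide_eq_true_eq]
  cases b
  · exact ((hV (index a)).not hw').congr fun x => by rw [assignment, decide_eq_false_iff_not]
  · exact ((hV (index a)).mono (by omega)).congr fun x => by rw [assignment, decide_eq_true_eq]

theorem selected_eq_some (hw : 2 ≤ w) (hV : ∀ a, HasDepth w D d (fun x => a ∈ V x))
    (F : Formula n) (hcap : 4 * (2 * n) ^ 3 + 1 < 2 ^ w) (c a : ℕ) :
    HasDepth w D (d + 8) (fun x => selected F (V x) c = some a) := by
  classical
  have hw' : 0 < w := by omega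
  have hclauses (s : Finset (Clause n)) : s.card < 2 ^ w := (card_clauses_le s).trans_lt hcap
  refine (exists_mem hw' F.toFinset (fun C _ => const_and fun _ => ?_) (hclauses _)).congr
    fun x => selected_eq_some_iff.symm
  have hvars : (C.vars.filter (· < a)).card < 2 ^ w := by
    calc (C.vars.filter (· < a)).card ≤ 3 :=
          (Finset.card_filter_le _ _).trans (Finset.card_image_le.trans C.card_le)
      _ < 2 ^ 2 := by norm_num
      _ ≤ 2 ^ w := Nat.pow_le_pow_right two_pos hw
  have hcount : HasDepth w D (d + 2)
      (fun x => ((C.vars.filter (· < a)).filter (· ∉ V x)).card = c) :=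
    (card_eq hw' _ (fun b _ => (hV b).not hw') hvars c).congr fun x => by congr!
  have hfirst : HasDepth w D (d + 5) (fun x => C.sat (assignment n (V x)) ≠ true ∧
      ∀ C' ∈ F.toFinset.filter (fun C' => F.idxOf C' < F.idxOf C),
        C'.sat (assignment n (V x)) = true) :=
    ((sat hw hV C).not hw').and hw (forall_mem hw' _ (fun C' _ => sat hw hV C') (hclauses _))
  exact hfirst.and hw
    ((((hV a).not hw').mono (by omega)).and hw (d := d + 4) (hcount.mono (by omega)))

theorem nextVar_eq (hw : 2 ≤ w) (hd : 2 ≤ d) (hV : ∀ a, HasDepth w D d (fun x => a ∈ V x))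
    (F : Formula n) (hcap : 4 * (2 * n) ^ 3 + 1 < 2 ^ w) {b T p : ℕ} (hD : regWires b T ⊆ D)
    (hp : p < T) (a : ℕ) :
    HasDepth w D (d + 13) (fun x => nextVar F (V x) (p + 1) (readTrit b x p) = a) := by
  have hw' : 0 < w := by omega
  have hn : n < 2 ^ w := by
    calc n ≤ 2 * n := by omega
      _ ≤ (2 * n) ^ 3 := Nat.le_self_pow (by norm_num) _
      _ ≤ 4 * (2 * n) ^ 3 + 1 := by omega
      _ < 2 ^ w := hcap
  have hchoice (c : Fin 3) : HasDepth w D (d + 10) (fun x => nextVar F (V x) (p + 1) c = a) := by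
    simp only [nextVar_eq_iff (Nat.succ_pos p)]
    split_ifs
    · exact forall_mem hw' _ (fun b _ => (selected_eq_some hw hV F hcap c b).not hw') (by simpa)
    · exact (selected_eq_some hw hV F hcap c a).mono (by omega)
  refine (exists_mem hw' Finset.univ (fun c _ =>
    ((readTrit_eq hw hD hp c).mono (by omega)).and hw (hchoice c)) ?_).congr fun x => ?_
  · calc (Finset.univ : Finset (Fin 3)).card < 2 ^ 2 := by simp
      _ ≤ 2 ^ w := Nat.pow_le_pow_right two_pos hw
  · simp

end HasDepth

/-! ### Computing into a register -/

/-- Add the bits `v` to the register of `k` wires that begins at the wire `o`. -/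
def xorReg (o k : ℕ) (v : ℕ → Bool) (x : ℕ → Bool) : ℕ → Bool :=
  fun i => if o ≤ i ∧ i < o + k then xor (x i) (v (i - o)) else x i

section XorReg

variable {o k i : ℕ} {v x : ℕ → Bool}

theorem xorReg_of_notMem (h : i < o ∨ o + k ≤ i) : xorReg o k v x i = x i :=
  if_neg (by omega)

theorem xorReg_add {j : ℕ} (hj : j < k) : xorReg o k v x (o + j) = xor (x (o + j)) (v j) := by
  rw [xorReg, if_pos ⟨by omega, by omega⟩, Nat.add_sub_cancel_left]

theorem xorReg_zero : xorReg o 0 v x = x :=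
  funext fun _ => if_neg (by omega)

theorem xorReg_succ : xorReg o (k + 1) v x =
    Function.update (xorReg o k v x) (o + k) (xor (x (o + k)) (v k)) := by
  funext i
  rcases eq_or_ne i (o + k) with rfl | hi
  · rw [Function.update_self, xorReg_add (Nat.lt_succ_self k)]
  · rw [Function.update_of_ne hi]
    unfold xorReg
    split_ifs <;> first | rfl | omega

theorem xorReg_congr {v' : ℕ → Bool} (h : ∀ j < k, v j = v' j) :
    xorReg o k v x = xorReg o k v' x := by
  funext i
  unfold xorReg
  split_ifs with hi
  · rw [h _ (by omega)]
  · rfl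

theorem xorReg_comm (o k o' k' : ℕ) (v v' x : ℕ → Bool) :
    xorReg o k v (xorReg o' k' v' x) = xorReg o' k' v' (xorReg o k v x) := by
  funext i
  unfold xorReg
  split_ifs <;> first | rfl | exact Bool.xor_right_comm ..

theorem Clean.xorReg_eq_setReg (h : Clean o k x) : xorReg o k v x = setReg o k v x := by
  funext i
  unfold xorReg setReg
  split_ifs with hi
  · rw [h i hi.1 hi.2, Bool.false_xor]
  · rfl

theorem Clean.xorReg {N a : ℕ} (h : Clean N a x) (ho : o + k ≤ N) : Clean N a (xorReg o k v x) :=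
  h.congr fun _ _ _ => xorReg_of_notMem (by omega)

end XorReg

/-- A circuit with at most `g` gates adds the first `k` bits of `E x` to the register that begins
at the wire `o`, using the `a` wires from `N` on as ancillas, and these bits depend only on the
wires in `D`. -/
def ComputesInto (D : Set ℕ) (N a g o k : ℕ) (E : (ℕ → Bool) → ℕ → Bool) : Prop :=
  (∀ j < k, DependsOn (fun x => E x j) D) ∧
    HasCircuit (N + a) g fun x y => Clean N a x ∧ y = xorReg o k (E x) x

theorem ComputesInto.mono {D : Set ℕ} {N a g o k a' g' : ℕ} {E : (ℕ → Bool) → ℕ → Bool}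
    (h : ComputesInto D N a g o k E) (ha : a ≤ a') (hg : g ≤ g') :
    ComputesInto D N a' g' o k E :=
  ⟨h.1, h.2.mono (by omega) hg fun _ _ ⟨hx, hy⟩ => ⟨hx.mono le_rfl (by omega), hy⟩⟩

theorem HasDepth.computesInto {w d N o k : ℕ} {D : Set ℕ} {E : (ℕ → Bool) → ℕ → Bool}
    (hE : ∀ j < k, HasDepth w D d (fun x => E x j = true)) (ho : o + k ≤ N)
    (hD : ∀ i ∈ D, i < N ∧ (i < o ∨ o + k ≤ i)) :
    ComputesInto D N (d * (2 * w + 1)) (k * 2 ^ (8 * w * d)) o k E := by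
  refine ⟨fun j hj x y hxy => Bool.eq_iff_iff.2 (iff_of_eq ((hE j hj).1 hxy)), ?_⟩
  induction k with
  | zero =>
    refine HasCircuit.refl.mono (Nat.zero_le _) (Nat.zero_le _) ?_
    rintro x y ⟨-, rfl⟩
    exact xorReg_zero.symm
  | succ k ih =>
    obtain ⟨hdep, hgate⟩ := hE k (Nat.lt_succ_self k)
    have hlow := ih (fun j hj => hE j (by omega)) (by omega)
      (fun i hi => by have := hD i hi; omega)
    have hbit := hgate (o + k) N (fun h => by have := hD _ h; omega) (by omega)
      (fun i hi => (hD i hi).1)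
    refine (hlow.comp hbit).mono le_rfl (Nat.succ_mul k _).ge ?_
    rintro x y ⟨hx, rfl⟩
    refine ⟨_, ⟨hx, rfl⟩, hx.xorReg (by omega), ?_⟩
    have hEk : (E (xorReg o k (E x) x) k = true) = (E x k = true) :=
      hdep fun i hi => xorReg_of_notMem (by have := hD i hi; omega)
    rw [xorReg_succ, xorReg_of_notMem (Or.inr le_rfl)]
    simp only [hEk, Bool.decide_eq_true]

theorem ComputesInto.comp {D : Set ℕ} {N a g₁ g₂ o k m : ℕ} {E₁ E₂ : (ℕ → Bool) → ℕ → Bool}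
    (h₁ : ComputesInto D (N + k) a g₁ N k E₁)
    (h₂ : ComputesInto (D ∪ Set.Ico N (N + k)) (N + k) a g₂ o m E₂)
    (ho : o + m ≤ N) (hD : ∀ i ∈ D, i < N ∧ (i < o ∨ o + m ≤ i)) :
    ComputesInto D N (k + a) (2 * g₁ + g₂) o m fun x => E₂ (setReg N k (E₁ x) x) := by
  refine ⟨fun j hj x y hxy => h₂.1 j hj fun i hi => ?_,
    (h₁.2.conj h₂.2).mono (by omega) le_rfl ?_⟩
  · unfold setReg
    split_ifs with hik
    · exact h₁.1 _ (by omega) hxy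
    · exact hxy i (hi.resolve_right hik)
  · rintro x y ⟨hx, rfl⟩
    have hN : Clean N k x := hx.mono le_rfl (by omega)
    have ha : Clean (N + k) a x := hx.mono (by omega) (by omega)
    refine ⟨_, _, ⟨ha, rfl⟩, ⟨ha.xorReg le_rfl, rfl⟩, ha.xorReg (by omega), ?_⟩
    have hE₁ : ∀ j < k, E₁ (xorReg o m (E₂ (setReg N k (E₁ x) x)) x) j = E₁ x j := fun j hj =>
      h₁.1 j hj fun i hi => xorReg_of_notMem (hD i hi).2
    rw [hN.xorReg_eq_setReg, xorReg_congr hE₁, xorReg_comm N, hN.xorReg_eq_setReg]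

/-! ### The list of flipped variables -/

theorem flipList_append_singleton {n : ℕ} (F : Formula n) (s : List (Fin 3)) (c : Fin 3) :
    flipList F (s ++ [c]) =
      flipList F s ++ [nextVar F (flipList F s).toFinset (s.length + 1) c] := by
  rw [← (flipList_spec F s).1]
  simp only [flipList, List.foldl_append, List.foldl_cons, List.foldl_nil]

theorem take_one_drop_flipList {n : ℕ} (F : Formula n) (s : List (Fin 3)) {i : ℕ}
    (hi : i < s.length) : ((flipList F s).drop i).take 1 =
      [nextVar F ((flipList F s).take i).toFinset (i + 1) s[i]] := by
  induction s using List.reverseRecOn with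
  | nil => simp at hi
  | append_singleton s c ih =>
    have hlen := (flipList_spec F s).1
    rw [List.length_append, List.length_singleton] at hi
    rw [flipList_append_singleton, List.drop_append_of_le_length (by omega),
      List.take_append_of_le_length (l₁ := flipList F s) (by omega)]
    rcases Nat.lt_or_eq_of_le (Nat.lt_succ_iff.1 hi) with h | rfl
    · rw [List.take_append_of_le_length (by rw [List.length_drop]; omega), ih h,
        List.getElem_append_left h]
    · rw [List.drop_of_length_le hlen.le, List.take_of_length_le hlen.le,
        List.getElem_concat_length rfl]
      rfl

/-- The variables selected in the rounds `i + 1, …, i + m`. -/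
def roundSet {n : ℕ} (F : Formula n) (s : List (Fin 3)) (i m : ℕ) : Finset ℕ :=
  (((flipList F s).drop i).take m).toFinset

section RoundSet

variable {n i m : ℕ} (F : Formula n) {s : List (Fin 3)}

theorem roundSet_union (i m m' : ℕ) :
    roundSet F s i m ∪ roundSet F s (i + m) m' = roundSet F s i (m + m') := by
  rw [roundSet, roundSet, roundSet, ← List.toFinset_append, List.take_add, List.drop_drop]

theorem roundSet_one (hi : i < s.length) :
    roundSet F s i 1 = {nextVar F (roundSet F s 0 i) (i + 1) s[i]} := by
  rw [roundSet, take_one_drop_flipList F s hi]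
  rfl

theorem card_roundSet (him : i + m ≤ s.length) : (roundSet F s i m).card = m := by
  obtain ⟨hlen, hnodup, -⟩ := flipList_spec F s
  have hsub : (((flipList F s).drop i).take m).Sublist (flipList F s) :=
    (List.take_sublist _ _).trans (List.drop_sublist _ _)
  rw [roundSet, List.toFinset_card_of_nodup (hnodup.sublist hsub), List.length_take,
    List.length_drop, hlen]
  omega

theorem roundSet_subset (hs : s.length ≤ n) : roundSet F s i m ⊆ Finset.Icc 1 (2 * n) := by
  intro y hy
  have := (flipList_spec F s).2.2 y
    (List.mem_of_mem_drop (List.mem_of_mem_take (List.mem_toFinset.1 hy)))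
  rw [Finset.mem_Icc]
  omega

theorem length_encReg_roundSet (hs : s.length ≤ n) (him : i + m ≤ s.length) :
    (encReg n (roundSet F s i m)).length = encLen n m := by
  have hcard := card_roundSet F him
  have hfit := length_encSet_le (roundSet F s i m)
    (fun y hy => Finset.mem_Icc.1 (roundSet_subset F hs hy)) (by omega)
  rw [encReg, List.length_rightpad, max_eq_left hfit, hcard]

theorem Holds.decodeSet_eq_roundSet {b : ℕ} {x : ℕ → Bool} (hs : s.length ≤ n)
    (him : i + m ≤ s.length) (h : Holds b (encLen n m) (encReg n (roundSet F s i m)) x) :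
    decodeSet (2 * n) (readTrits b (encLen n m) x) = roundSet F s i m := by
  rw [h.readTrits_eq (length_encReg_roundSet F hs him), encReg, List.rightpad]
  refine decodeSet_encSet_append (roundSet_subset F hs) fun h₂ => ?_
  exact absurd (List.eq_of_mem_replicate h₂) (by decide)

end RoundSet

/-! ### Blocks of rounds -/

theorem encLen_le {n k : ℕ} (hkn : k ≤ n) : encLen n k ≤ 5 * n := by
  rcases Nat.eq_zero_or_pos k with rfl | hk
  · simp [encLen]
  have hk' : (0 : ℝ) < k := by exact_mod_cast hk
  have hlog : Real.logb 2 ((n : ℝ) / k) ≤ (n : ℝ) / k := by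
    rw [Real.logb_le_iff_le_rpow one_lt_two (div_pos (by exact_mod_cast hk.trans_le hkn) hk')]
    have bernoulli := one_add_mul_self_le_rpow_one_add (s := 1) (by norm_num) (p := (n : ℝ) / k)
      (by rw [one_le_div hk']; exact_mod_cast hkn)
    norm_num at bernoulli
    linarith
  have hceil : ⌈(k : ℝ) * Real.logb 2 ((n : ℝ) / k)⌉₊ ≤ n := Nat.ceil_le.2 <|
    calc (k : ℝ) * Real.logb 2 ((n : ℝ) / k) ≤ k * ((n : ℝ) / k) := by gcongr
      _ = n := mul_div_cancel₀ _ hk'.ne'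
  unfold encLen
  omega

/-- The bits of the register for the set `S`. -/
noncomputable def regBits (n : ℕ) (S : Finset ℕ) (j : ℕ) : Bool :=
  ((encReg n S).flatMap tritBits).getD j false

/-- The wires that hold the choices of `r` rounds and the registers of a list. -/
def inputWires (r : ℕ) (regs : List (ℕ × ℕ)) : Set ℕ :=
  regWires 0 r ∪ {j | ∃ g ∈ regs, j ∈ regWires g.1 g.2}

/-- Size bounds for the registers that store the variables of the first `i` rounds: each register
stores at least one round, and `encLen n m ≤ 5 * n` for `m ≤ n`. -/
structure RoundRegs (n i : ℕ) (regs : List (ℕ × ℕ)) : Prop where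
  length_le : regs.length ≤ i
  size_le : ∀ g ∈ regs, g.2 ≤ 5 * n

/-- The wires hold the choices `s` of `r` rounds, and the registers of the list contain the
variables that are selected in the first `i` rounds. -/
structure HoldsRounds {n : ℕ} (F : Formula n) (r : ℕ) (s : List (Fin 3)) (regs : List (ℕ × ℕ))
    (i : ℕ) (x : ℕ → Bool) : Prop where
  length_eq : s.length = r
  holds : Holds 0 r s x
  decodeRegs_eq : decodeRegs (2 * n) regs x = roundSet F s 0 i

/-- Given registers for the first `i` rounds, a circuit with at most `g` gates adds the register
for the next `m` rounds to the wires from `o` on, using the `a` wires from `N` on as ancillas. -/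
def ComputesRounds {n : ℕ} (F : Formula n) (r : ℕ) (regs : List (ℕ × ℕ)) (i m N a g o : ℕ) : Prop :=
  ∃ E : (ℕ → Bool) → ℕ → Bool,
    ComputesInto (inputWires r regs) N a g o (2 * encLen n m) E ∧
      ∀ x s, HoldsRounds F r s regs i x → E x = regBits n (roundSet F s i m)

theorem regWires_subset_inputWires {r : ℕ} {regs : List (ℕ × ℕ)} {g : ℕ × ℕ} (hg : g ∈ regs) :
    regWires g.1 g.2 ⊆ inputWires r regs :=
  fun _ hj => Or.inr ⟨g, hg, hj⟩

theorem inputWires_append_singleton (r : ℕ) (regs : List (ℕ × ℕ)) (b T : ℕ) :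
    inputWires r (regs ++ [(b, T)]) = inputWires r regs ∪ regWires b T := by
  ext j
  simp [inputWires, or_and_right, exists_or, or_assoc]

theorem RoundRegs.append {n i m : ℕ} {regs : List (ℕ × ℕ)} (h : RoundRegs n i regs) (hm : 0 < m)
    (hmn : m ≤ n) (b : ℕ) : RoundRegs n (i + m) (regs ++ [(b, encLen n m)]) where
  length_le := by
    rw [List.length_append, List.length_singleton]
    exact Nat.add_le_add h.length_le hm
  size_le := List.forall_mem_append.2 ⟨h.size_le, by simpa using encLen_le hmn⟩

theorem holds_setReg_regBits (n b T : ℕ) (S : Finset ℕ) (x : ℕ → Bool) :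
    Holds b T (encReg n S) (setReg b (2 * T) (regBits n S) x) := fun i hi => by
  rw [setReg, if_pos (by omega), Nat.add_sub_cancel_left, regBits]

theorem decodeSet_setReg_regBits {n i m b : ℕ} (F : Formula n) {s : List (Fin 3)}
    (hs : s.length ≤ n) (him : i + m ≤ s.length) (x : ℕ → Bool) :
    decodeSet (2 * n) (readTrits b (encLen n m)
      (setReg b (2 * encLen n m) (regBits n (roundSet F s i m)) x)) = roundSet F s i m :=
  (holds_setReg_regBits n b _ _ x).decodeSet_eq_roundSet F hs him

theorem decodeRegs_setReg_setReg {n i m m' b : ℕ} (F : Formula n) {s : List (Fin 3)}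
    (hs : s.length ≤ n) (him : i + (m + m') ≤ s.length) (x : ℕ → Bool) :
    decodeRegs (2 * n) [(b, encLen n m), (b + 2 * encLen n m, encLen n m')]
      (setReg (b + 2 * encLen n m) (2 * encLen n m') (regBits n (roundSet F s (i + m) m'))
        (setReg b (2 * encLen n m) (regBits n (roundSet F s i m)) x)) =
      roundSet F s i (m + m') := by
  have first_unchanged (v y : ℕ → Bool) : readTrits b (encLen n m)
      (setReg (b + 2 * encLen n m) (2 * encLen n m') v y) = readTrits b (encLen n m) y :=
    readTrits_congr fun j hj => setReg_of_notMem (Or.inl hj.2)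
  rw [show [(b, encLen n m), (b + 2 * encLen n m, encLen n m')] =
      [] ++ [(b, encLen n m)] ++ [(b + 2 * encLen n m, encLen n m')] from rfl,
    decodeRegs_append_singleton, decodeRegs_append_singleton, first_unchanged,
    decodeSet_setReg_regBits F hs (by omega), decodeSet_setReg_regBits F hs (by omega),
    ← roundSet_union]
  simp [decodeRegs]

theorem HoldsRounds.append {n r i m b : ℕ} {F : Formula n} {s : List (Fin 3)}
    {regs : List (ℕ × ℕ)} {x : ℕ → Bool} (h : HoldsRounds F r s regs i x) (hr : r ≤ n)
    (him : i + m ≤ r) (hb : ∀ j ∈ inputWires r regs, j < b) :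
    HoldsRounds F r s (regs ++ [(b, encLen n m)]) (i + m)
      (setReg b (2 * encLen n m) (regBits n (roundSet F s i m)) x) := by
  obtain ⟨rfl, hx, hdec⟩ := h
  refine ⟨rfl, fun j hj => ?_, ?_⟩
  · rw [setReg_of_notMem (Or.inl (hb _ (Or.inl ⟨by omega, by omega⟩))), hx j hj]
  · have old : decodeRegs (2 * n) regs
        (setReg b (2 * encLen n m) (regBits n (roundSet F s i m)) x) = roundSet F s 0 i := by
      rw [← hdec]
      exact decodeRegs_congr fun g hg j hj =>
        setReg_of_notMem (Or.inl (hb j (regWires_subset_inputWires hg hj)))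
    rw [decodeRegs_append_singleton, decodeSet_setReg_regBits F hr him, old]
    simpa using roundSet_union F (s := s) 0 i m

section Capacity

variable {n w : ℕ}

theorem two_le_of_capacity (hcap : (7 * n + 2) ^ 3 < 2 ^ w) : 2 ≤ w := by
  have : 2 ^ 3 < 2 ^ w := lt_of_le_of_lt (by gcongr; omega) hcap
  have := (Nat.pow_lt_pow_iff_right one_lt_two).1 this
  omega

theorem ten_mul_le_of_capacity (hcap : (7 * n + 2) ^ 3 < 2 ^ w) : 10 * n ≤ 2 ^ w :=
  calc 10 * n ≤ (7 * n + 2) * 2 ^ 2 := by omega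
    _ ≤ (7 * n + 2) * (7 * n + 2) ^ 2 := by gcongr; omega
    _ = (7 * n + 2) ^ 3 := by ring
    _ ≤ 2 ^ w := hcap.le

theorem four_mul_pow_lt_of_capacity (hcap : (7 * n + 2) ^ 3 < 2 ^ w) :
    4 * (2 * n) ^ 3 + 1 < 2 ^ w := by
  have : (7 * n + 2) ^ 3 = 4 * (2 * n) ^ 3 + (311 * n ^ 3 + 294 * n ^ 2 + 84 * n + 8) := by ring
  omega

/-- The constants `31` and `249` are `23 + 8` and `31 * 8 + 1`. -/
theorem computesInto_regBits {D : Set ℕ} {S : (ℕ → Bool) → Finset ℕ} {N o m : ℕ}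
    (hcap : (7 * n + 2) ^ 3 < 2 ^ w) (hm : m ≤ n) (hS : ∀ a, HasDepth w D 23 fun x => a ∈ S x)
    (hSU : ∀ x, S x ⊆ Finset.Icc 1 (2 * n)) (ho : o + 2 * encLen n m ≤ N)
    (hD : ∀ j ∈ D, j < N ∧ (j < o ∨ o + 2 * encLen n m ≤ j)) :
    ComputesInto D N (31 * (2 * w + 1)) (2 ^ (249 * w)) o (2 * encLen n m)
      fun x => regBits n (S x) := by
  have hlen : encLen n m ≤ 5 * n := encLen_le hm
  refine (HasDepth.computesInto (d := 31) (fun j hj => HasDepth.getD_encReg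
    (two_le_of_capacity hcap) n hS hSU (lt_of_le_of_lt ?_ hcap)) ho hD).mono le_rfl ?_
  · gcongr
    omega
  · calc 2 * encLen n m * 2 ^ (8 * w * 31) ≤ 2 ^ w * 2 ^ (8 * w * 31) := by
          gcongr
          exact (by omega : 2 * encLen n m ≤ 10 * n).trans (ten_mul_le_of_capacity hcap)
      _ = 2 ^ (249 * w) := by rw [← pow_add]; congr 1; omega

theorem computesRounds_one {r i N o : ℕ} {regs : List (ℕ × ℕ)} (hcap : (7 * n + 2) ^ 3 < 2 ^ w)
    (F : Formula n) (hr : r ≤ n) (hi : i < r) (hregs : RoundRegs n i regs)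
    (ho : o + 2 * encLen n 1 ≤ N)
    (hD : ∀ j ∈ inputWires r regs, j < N ∧ (j < o ∨ o + 2 * encLen n 1 ≤ j)) :
    ComputesRounds F r regs i 1 N (31 * (2 * w + 1)) (2 ^ (249 * w)) o := by
  have hw := two_le_of_capacity hcap
  have hlen : regs.length < 2 ^ w := by
    have := hregs.length_le
    have := ten_mul_le_of_capacity hcap
    omega
  have selected_before (a : ℕ) : HasDepth w (inputWires r regs) 10
      fun x => a ∈ decodeRegs (2 * n) regs x :=
    HasDepth.mem_decodeRegs hw (fun g => regWires_subset_inputWires) hregs.size_le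
      (by convert hcap using 2; ring) hlen a
  have selected_now (a : ℕ) : HasDepth w (inputWires r regs) 23 fun x =>
      a ∈ ({nextVar F (decodeRegs (2 * n) regs x) (i + 1) (readTrit 0 x i)} : Finset ℕ) :=
    (HasDepth.nextVar_eq hw (by omega) selected_before F (four_mul_pow_lt_of_capacity hcap)
      Set.subset_union_left hi a).congr fun x => by rw [Finset.mem_singleton, eq_comm]
  refine ⟨_, computesInto_regBits hcap (by omega) selected_now (fun x => ?_) ho hD, ?_⟩
  · have := nextVar_spec F (decodeRegs (2 * n) regs x) (i + 1) (readTrit 0 x i)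
    rw [Finset.singleton_subset_iff, Finset.mem_Icc]
    omega
  · rintro x s ⟨rfl, hx, hdec⟩
    rw [hdec, hx.readTrit_eq hi hi, roundSet_one F hi]

theorem computesInto_merge {N o b b' m m' : ℕ} {D : Set ℕ} (hcap : (7 * n + 2) ^ 3 < 2 ^ w)
    (hm : m + m' ≤ n) (hb : regWires b (encLen n m) ⊆ D) (hb' : regWires b' (encLen n m') ⊆ D)
    (ho : o + 2 * encLen n (m + m') ≤ N)
    (hD : ∀ j ∈ D, j < N ∧ (j < o ∨ o + 2 * encLen n (m + m') ≤ j)) :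
    ComputesInto D N (31 * (2 * w + 1)) (2 ^ (249 * w)) o (2 * encLen n (m + m'))
      fun x => regBits n (decodeRegs (2 * n) [(b, encLen n m), (b', encLen n m')] x) := by
  have hw := two_le_of_capacity hcap
  have htwo : [(b, encLen n m), (b', encLen n m')].length < 2 ^ w :=
    lt_of_lt_of_le (by decide : 2 < 2 ^ 2) (Nat.pow_le_pow_right two_pos hw)
  exact computesInto_regBits hcap hm (fun a => (HasDepth.mem_decodeRegs hw
    (by simpa using ⟨hb, hb'⟩)
    (by simpa using ⟨encLen_le (by omega : m ≤ n), encLen_le (by omega : m' ≤ n)⟩)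
    (by convert hcap using 2; ring) htwo a).mono (by omega))
    (fun _ => decodeRegs_subset _ _ _) ho hD

/-- Both parts of the block are computed into temporary registers behind `N`, merged, and
uncomputed again. -/
theorem ComputesRounds.add {F : Formula n} {r i m m' N a g g' o : ℕ} {regs : List (ℕ × ℕ)}
    (hcap : (7 * n + 2) ^ 3 < 2 ^ w) (hr : r ≤ n) (him : i + (m + m') ≤ r)
    (ha : 31 * (2 * w + 1) ≤ a) (ho : o + 2 * encLen n (m + m') ≤ N)
    (hD : ∀ j ∈ inputWires r regs, j < N ∧ (j < o ∨ o + 2 * encLen n (m + m') ≤ j))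
    (h : ComputesRounds F r regs i m (N + 2 * encLen n m) (2 * encLen n m' + a) g N)
    (h' : ComputesRounds F r (regs ++ [(N, encLen n m)]) (i + m) m'
      (N + 2 * encLen n m + 2 * encLen n m') a g' (N + 2 * encLen n m)) :
    ComputesRounds F r regs i (m + m') N (2 * encLen n m + (2 * encLen n m' + a))
      (2 * g + (2 * g' + 2 ^ (249 * w))) o := by
  obtain ⟨E, hE, hspec⟩ := h
  obtain ⟨E', hE', hspec'⟩ := h'
  rw [inputWires_append_singleton] at hE'
  have hD' : ∀ j ∈ inputWires r regs ∪ regWires N (encLen n m),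
      j < N + 2 * encLen n m ∧ (j < o ∨ o + 2 * encLen n (m + m') ≤ j) := by
    rintro j (hj | ⟨hj, hj'⟩)
    · have := hD j hj; omega
    · omega
  have merge := (computesInto_merge (o := o) (b := N) (b' := N + 2 * encLen n m)
    (N := N + 2 * encLen n m + 2 * encLen n m') hcap (by omega : m + m' ≤ n)
    (Set.subset_union_of_subset_left Set.subset_union_right _) Set.subset_union_right (by omega)
    (by
      rintro j (hj | ⟨hj, hj'⟩)
      · have := hD' j hj; omega
      · omega)).mono ha le_rfl
  refine ⟨_, hE.comp (hE'.comp merge (by omega) hD') ho hD, fun x s hx => ?_⟩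
  have hs : s.length = r := hx.length_eq
  rw [hspec x s hx, hspec' _ s (hx.append hr (by omega) fun j hj => (hD j hj).1),
    decodeRegs_setReg_setReg F (by omega) (by omega)]

/-- The number of ancillas for a block of `2 ^ e` rounds: each halving stores the registers of both
half-blocks, and `31 * (2 * w + 1)` wires suffice to add one register to another. -/
noncomputable def blockAncillas (n w : ℕ) : ℕ → ℕ
  | 0 => 31 * (2 * w + 1)
  | e + 1 => 4 * encLen n (2 ^ e) + blockAncillas n w e

theorem le_blockAncillas (n w e : ℕ) : 31 * (2 * w + 1) ≤ blockAncillas n w e := by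
  induction e with
  | zero => exact le_rfl
  | succ e ih => exact ih.trans (Nat.le_add_left _ _)

theorem ComputesRounds.mono {F : Formula n} {r i m N a a' g g' o : ℕ} {regs : List (ℕ × ℕ)}
    (h : ComputesRounds F r regs i m N a g o) (ha : a ≤ a') (hg : g ≤ g') :
    ComputesRounds F r regs i m N a' g' o :=
  let ⟨E, hE, hspec⟩ := h
  ⟨E, hE.mono ha hg, hspec⟩

theorem computesRounds_two_pow (hcap : (7 * n + 2) ^ 3 < 2 ^ w) (F : Formula n) {r : ℕ} (hr : r ≤ n)
    {i e N o : ℕ} {regs : List (ℕ × ℕ)} (hi : i + 2 ^ e ≤ r) (hregs : RoundRegs n i regs)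
    (ho : o + 2 * encLen n (2 ^ e) ≤ N)
    (hD : ∀ j ∈ inputWires r regs, j < N ∧ (j < o ∨ o + 2 * encLen n (2 ^ e) ≤ j)) :
    ComputesRounds F r regs i (2 ^ e) N (blockAncillas n w e) (8 ^ e * 2 ^ (249 * w)) o := by
  induction e generalizing i N o regs with
  | zero => simpa [blockAncillas] using computesRounds_one hcap F hr hi hregs ho hD
  | succ e ih =>
    have hpos := Nat.two_pow_pos e
    rw [show 2 ^ (e + 1) = 2 ^ e + 2 ^ e by ring] at *
    have first := ih (N := N + 2 * encLen n (2 ^ e)) (o := N) (by omega) hregs le_rfl fun j hj => by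
      have := hD j hj; omega
    have second := ih (i := i + 2 ^ e) (N := N + 2 * encLen n (2 ^ e) + 2 * encLen n (2 ^ e))
      (o := N + 2 * encLen n (2 ^ e)) (by omega)
      (hregs.append hpos (by omega) N) le_rfl (by
        rw [inputWires_append_singleton]
        rintro j (hj | hj)
        · have := hD j hj; omega
        · rw [Set.mem_Ico] at hj; omega)
    refine (ComputesRounds.add hcap hr hi (le_blockAncillas n w e) ho hD
      (first.mono (by omega) le_rfl) second).mono (by rw [blockAncillas]; omega) ?_
    have : 2 ^ (249 * w) ≤ 8 ^ e * 2 ^ (249 * w) := Nat.le_mul_of_pos_left _ (by positivity)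
    rw [pow_succ, mul_right_comm]
    omega

end Capacity

/-! ### All rounds -/

/-- The number of trits of the registers for blocks of `2 ^ e` rounds, `e ∈ es`. -/
noncomputable def blocksLen (n : ℕ) (es : List ℕ) : ℕ := (es.map fun e => encLen n (2 ^ e)).sum

/-- The contents of the registers for consecutive blocks of `2 ^ e` rounds, `e ∈ es`, after the
first `i` rounds. -/
noncomputable def blocksEnc {n : ℕ} (F : Formula n) (s : List (Fin 3)) (i : ℕ) (es : List ℕ) :
    List (Fin 3) :=
  ((es.map (2 ^ ·)).splitLengths ((flipList F s).drop i)).flatMap fun B => encReg n B.toFinset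

/-- Given registers for the first `i` rounds, a circuit with at most `g` gates writes the registers
for the next blocks of `2 ^ e` rounds, `e ∈ es`, to the wires from `o` on, using the `a` wires from
`N` on as ancillas. -/
def ComputesBlocks {n : ℕ} (F : Formula n) (r : ℕ) (regs : List (ℕ × ℕ)) (i : ℕ) (es : List ℕ)
    (N a g o : ℕ) : Prop :=
  ∃ T : (ℕ → Bool) → ℕ → Bool,
    (∀ x j, (j < o ∨ o + 2 * blocksLen n es ≤ j) → T x j = x j) ∧
    HasCircuit (N + a) g (fun x y => Clean N a x ∧ y = T x) ∧
    ∀ x s, HoldsRounds F r s regs i x → Clean o (2 * blocksLen n es) x →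
      Holds o (blocksLen n es) (blocksEnc F s i es) (T x)

theorem blocksLen_cons (n e : ℕ) (es : List ℕ) :
    blocksLen n (e :: es) = encLen n (2 ^ e) + blocksLen n es := rfl

theorem blocksEnc_cons {n : ℕ} (F : Formula n) (s : List (Fin 3)) (i e : ℕ) (es : List ℕ) :
    blocksEnc F s i (e :: es) =
      encReg n (roundSet F s i (2 ^ e)) ++ blocksEnc F s (i + 2 ^ e) es := by
  simp [blocksEnc, roundSet]

theorem length_flatMap_tritBits (l : List (Fin 3)) :
    (l.flatMap tritBits).length = 2 * l.length := by
  induction l with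
  | nil => rfl
  | cons t l ih =>
    rw [List.flatMap_cons, List.length_append, ih, List.length_cons, Nat.mul_succ, Nat.add_comm]
    rfl

theorem Holds.append {b T T' : ℕ} {l l' : List (Fin 3)} {x : ℕ → Bool} (h : Holds b T l x)
    (hl : l.length = T) (h' : Holds (b + 2 * T) T' l' x) : Holds b (T + T') (l ++ l') x := by
  have hlen : (l.flatMap tritBits).length = 2 * T := by rw [length_flatMap_tritBits, hl]
  intro j hj
  rw [List.flatMap_append]
  rcases lt_or_ge j (2 * T) with hjT | hjT
  · rw [List.getD_append _ _ _ _ (by omega), h j hjT]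
  · rw [List.getD_append_right _ _ _ _ (by omega), hlen, ← h' (j - 2 * T) (by omega)]
    congr 1
    omega

theorem ComputesBlocks.nil {n : ℕ} (F : Formula n) (r : ℕ) (regs : List (ℕ × ℕ))
    (i N a g o : ℕ) : ComputesBlocks F r regs i [] N a g o :=
  ⟨id, fun _ _ _ => rfl,
    HasCircuit.refl.mono (Nat.zero_le _) (Nat.zero_le _) fun _ _ ⟨_, hy⟩ => hy.symm,
    fun _ _ _ _ _ hj => absurd hj (Nat.not_lt_zero _)⟩

theorem ComputesBlocks.cons {n r i e N a g g' o : ℕ} {F : Formula n} {regs : List (ℕ × ℕ)}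
    {es : List ℕ} (hr : r ≤ n) (hi : i + 2 ^ e ≤ r) (ho : o + 2 * blocksLen n (e :: es) ≤ N)
    (hD : ∀ j ∈ inputWires r regs, j < o) (h : ComputesRounds F r regs i (2 ^ e) N a g o)
    (h' : ComputesBlocks F r (regs ++ [(o, encLen n (2 ^ e))]) (i + 2 ^ e) es N a g'
      (o + 2 * encLen n (2 ^ e))) :
    ComputesBlocks F r regs i (e :: es) N a (g + g') o := by
  obtain ⟨E, hE, hspec⟩ := h
  obtain ⟨T, outside, hT, hspec'⟩ := h'
  rw [blocksLen_cons] at ho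
  refine ⟨fun x => T (xorReg o (2 * encLen n (2 ^ e)) (E x) x), fun x j hj => ?_,
    (hE.2.comp hT).mono le_rfl le_rfl ?_, fun x s hx hclean => ?_⟩
  · rw [blocksLen_cons] at hj
    exact (outside _ j (by omega)).trans (xorReg_of_notMem (by omega))
  · rintro x _ ⟨hx, rfl⟩
    exact ⟨_, ⟨hx, rfl⟩, hx.xorReg (by omega), rfl⟩
  · have hs : s.length = r := hx.length_eq
    rw [blocksLen_cons] at hclean ⊢
    have written : xorReg o (2 * encLen n (2 ^ e)) (E x) x =
        setReg o (2 * encLen n (2 ^ e)) (regBits n (roundSet F s i (2 ^ e))) x := by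
      rw [hspec x s hx, (hclean.mono le_rfl (by omega)).xorReg_eq_setReg]
    simp only [blocksEnc_cons, written]
    refine Holds.append (fun j hj => ?_) (length_encReg_roundSet F (by omega) (by omega))
      (hspec' _ s (hx.append hr hi hD)
        ((hclean.mono (by omega) (by omega)).congr fun j _ _ => setReg_of_notMem (by omega)))
    rw [outside _ _ (by omega)]
    exact holds_setReg_regBits n o _ _ x j hj

theorem computesBlocks {n w r a Q N : ℕ} (hcap : (7 * n + 2) ^ 3 < 2 ^ w) (F : Formula n)
    (hr : r ≤ n) {es : List ℕ} (ha : ∀ e ∈ es, blockAncillas n w e ≤ a)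
    (hQ : ∀ e ∈ es, 8 ^ e * 2 ^ (249 * w) ≤ Q) {i : ℕ} (hi : i + (es.map (2 ^ ·)).sum ≤ r)
    {regs : List (ℕ × ℕ)} (hregs : RoundRegs n i regs) {o : ℕ} (ho : o + 2 * blocksLen n es ≤ N)
    (hD : ∀ j ∈ inputWires r regs, j < o) :
    ComputesBlocks F r regs i es N a (es.length * Q) o := by
  induction es generalizing i regs o with
  | nil => exact ComputesBlocks.nil ..
  | cons e es ih =>
    rw [List.forall_mem_cons] at ha hQ
    rw [List.map_cons, List.sum_cons] at hi
    have hlen := blocksLen_cons n e es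
    have rounds := (computesRounds_two_pow (N := N) (o := o) hcap F hr (by omega) hregs (by omega)
      fun j hj => by have := hD j hj; omega).mono ha.1 hQ.1
    have rest := ih ha.2 hQ.2 (i := i + 2 ^ e) (by omega)
      (hregs.append (Nat.two_pow_pos e) (by omega) o) (o := o + 2 * encLen n (2 ^ e)) (by omega) (by
        rw [inputWires_append_singleton]
        rintro j (hj | ⟨-, hj⟩)
        · have := hD j hj; omega
        · exact hj)
    rw [List.length_cons, Nat.succ_mul, Nat.add_comm]
    exact ComputesBlocks.cons hr (by omega) ho hD rounds rest

/-- The wires hold the bits of `x`, followed by zeros. -/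
noncomputable def zeroExt {q : ℕ} (x : Fin q → Bool) : ℕ → Bool :=
  Function.extend Fin.val x fun _ => false

section ZeroExt

variable {q : ℕ}

theorem zeroExt_val (x : Fin q → Bool) (i : Fin q) : zeroExt x i = x i :=
  Fin.val_injective.extend_apply _ _ i

theorem zeroExt_of_le (x : Fin q → Bool) {i : ℕ} (hi : q ≤ i) : zeroExt x i = false :=
  Function.extend_apply' _ _ _ fun ⟨_, _⟩ => by omega

theorem append_zeros {y : ℕ → Bool} (hy : ∀ i, q ≤ i → y i = false) (l : ℕ) :
    Fin.append (fun i : Fin q => y i) (zeros l) = fun i : Fin (q + l) => y i := by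
  funext i
  refine Fin.addCases (fun j => ?_) (fun j => ?_) i
  · rw [Fin.append_left, Fin.val_castAdd]
  · rw [Fin.append_right, hy _ (Fin.le_coe_natAdd q j), zeros]

theorem zeroExt_restrict {y : ℕ → Bool} (hy : ∀ i, q ≤ i → y i = false) :
    zeroExt (fun i : Fin q => y i) = y := by
  funext i
  rcases lt_or_ge i q with hi | hi
  · exact zeroExt_val (fun i : Fin q => y i) ⟨i, hi⟩
  · rw [zeroExt_of_le _ hi, hy i hi]

end ZeroExt

theorem HasCircuit.exists_perm {q l g : ℕ} {T : (ℕ → Bool) → ℕ → Bool}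
    (h : HasCircuit (q + l) g fun x y => Clean q l x ∧ y = T x)
    (hT : ∀ x i, q ≤ i → T x i = x i) :
    ∃ f : Equiv.Perm (Fin q → Bool), ImplementableReversibly f l g ∧
      ∀ x : ℕ → Bool, (∀ i, q ≤ i → x i = false) → f (fun i => x i) = fun i : Fin q => T x i := by
  obtain ⟨c, hlen, hc, hrun⟩ := h
  have run_zeroExt (x : Fin q → Bool) : runWires c (zeroExt x) = T (zeroExt x) :=
    hrun _ _ ⟨fun i hi _ => zeroExt_of_le x hi, rfl⟩
  have tail_zero (x : Fin q → Bool) (i : ℕ) (hi : q ≤ i) : T (zeroExt x) i = false := by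
    rw [hT _ _ hi, zeroExt_of_le x hi]
  have injective :
      Function.Injective fun (x : Fin q → Bool) (i : Fin q) => T (zeroExt x) i := fun x y hxy => by
    have outputs_eq : T (zeroExt x) = T (zeroExt y) := by
      rw [← zeroExt_restrict (tail_zero x), ← zeroExt_restrict (tail_zero y)]
      exact congrArg zeroExt hxy
    have inputs_eq : zeroExt x = zeroExt y := by
      rw [← runWires_reverse hc (zeroExt x), run_zeroExt, outputs_eq, ← run_zeroExt,
        runWires_reverse hc]
    funext i
    rw [← zeroExt_val x, inputs_eq, zeroExt_val]
  obtain ⟨c', hlen', hrun'⟩ := exists_circuit c hc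
  refine ⟨Equiv.ofBijective _ (Finite.injective_iff_bijective.1 injective),
    ⟨c', hlen'.trans_le hlen, fun x => ?_⟩, fun x hx => ?_⟩
  · rw [Equiv.ofBijective_apply, append_zeros (tail_zero x), ← run_zeroExt, ← hrun',
      ← append_zeros (fun i => zeroExt_of_le x) l]
    simp only [zeroExt_val]
  · rw [Equiv.ofBijective_apply, zeroExt_restrict hx]

theorem length_bitIndices_le (r : ℕ) : r.bitIndices.length ≤ r := by
  have one_le : ∀ y ∈ r.bitIndices.map (2 ^ ·), 1 ≤ y :=
    List.forall_mem_map.2 fun e _ => Nat.one_le_two_pow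
  simpa using List.card_nsmul_le_sum _ 1 one_le

theorem effEncLen_eq_blocksLen (n r : ℕ) : effEncLen n r = blocksLen n r.bitIndices.reverse := by
  rw [effEncLen, blockSizes, List.map_map]
  rfl

theorem effEnc_eq_blocksEnc {n : ℕ} (F : Formula n) (s : List (Fin 3)) :
    effEnc F s = blocksEnc F s 0 s.length.bitIndices.reverse := by
  rw [effEnc, blockSizes, blocksEnc, List.drop_zero]

theorem exists_perm_effEnc {n r w a Q : ℕ} (hcap : (7 * n + 2) ^ 3 < 2 ^ w) (F : Formula n)
    (hr : r ≤ n) (ha : ∀ e, 2 ^ e ≤ r → blockAncillas n w e ≤ a)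
    (hQ : ∀ e, 2 ^ e ≤ r → 8 ^ e * 2 ^ (249 * w) ≤ Q) :
    ∃ f : Equiv.Perm (Fin (2 * r + 2 * effEncLen n r) → Bool),
      ImplementableReversibly f a (r * Q) ∧ ∀ s : Fin r → Fin 3,
        f (Fin.append (tritReg r (List.ofFn s)) (zeros (2 * effEncLen n r))) =
          Fin.append (tritReg r (List.ofFn s))
            (tritReg (effEncLen n r) (effEnc F (List.ofFn s))) := by
  have hmem (e : ℕ) (he : e ∈ r.bitIndices.reverse) : 2 ^ e ≤ r :=
    Nat.two_pow_le_of_mem_bitIndices (List.mem_reverse.1 he)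
  have hlen := effEncLen_eq_blocksLen n r
  obtain ⟨T, outside, circuit, hspec⟩ := computesBlocks (N := 2 * r + 2 * effEncLen n r)
    hcap F hr (fun e he => ha e (hmem e he)) (fun e he => hQ e (hmem e he)) (i := 0) (regs := [])
    (by rw [zero_add]; exact (sum_blockSizes r).le) ⟨le_rfl, by simp⟩ (o := 2 * r) (by rw [hlen])
    (by simp [inputWires])
  rw [← hlen] at outside hspec
  rw [List.length_reverse] at circuit
  obtain ⟨f, hf, hfT⟩ := (circuit.mono le_rfl (Nat.mul_le_mul_right Q (length_bitIndices_le r))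
    fun _ _ => id).exists_perm fun x i hi => outside x i (Or.inr hi)
  refine ⟨f, hf, fun s => ?_⟩
  set l := List.ofFn s
  have hlr : l.length = r := List.length_ofFn
  set x : ℕ → Bool := fun i => (l.flatMap tritBits).getD i false
  have tail_zero (i : ℕ) (hi : 2 * r ≤ i) : x i = false :=
    List.getD_eq_default _ _ (by rw [length_flatMap_tritBits]; omega)
  have holds := hspec x l ⟨hlr, fun i _ => by rw [Nat.zero_add], by simp [decodeRegs, roundSet]⟩
    fun i hi _ => tail_zero i hi
  have input : Fin.append (tritReg r l) (zeros (2 * effEncLen n r)) = fun i : Fin _ => x i :=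
    append_zeros tail_zero _
  rw [input, hfT x fun i hi => tail_zero i (by omega)]
  funext i
  refine Fin.addCases (fun j => ?_) (fun j => ?_) i
  · rw [Fin.append_left]
    exact outside x j (Or.inl j.2)
  · rw [Fin.append_right, effEnc_eq_blocksEnc, hlr]
    exact holds j j.2

/-! ### Bounds -/

section Bounds

variable {n r : ℕ}

theorem mul_logb_div_nonneg (hr : r ≤ n) : 0 ≤ r * Real.logb 2 ((n : ℝ) / r) := by
  rcases Nat.eq_zero_or_pos r with rfl | hr0
  · simp
  · have hr0' : (0 : ℝ) < r := by exact_mod_cast hr0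
    exact mul_nonneg hr0'.le <| Real.logb_nonneg one_lt_two <|
      (one_le_div hr0').2 (by exact_mod_cast hr)

theorem encLen_two_pow_le {e : ℕ} (he : 2 ^ e ≤ n) :
    (encLen n (2 ^ e) : ℝ) ≤ 2 ^ e * (Real.logb 2 n - e + 5) := by
  have hn : (n : ℝ) ≠ 0 := by exact_mod_cast ((Nat.two_pow_pos e).trans_le he).ne'
  have hlog : Real.logb 2 ((n : ℝ) / (2 ^ e : ℕ)) = Real.logb 2 n - e := by
    rw [Nat.cast_pow, Nat.cast_ofNat, Real.logb_div hn (by positivity), Real.logb_pow,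
      Real.logb_self_eq_one one_lt_two, mul_one]
  have hceil := Nat.ceil_lt_add_one (mul_logb_div_nonneg he)
  have hone : (1 : ℝ) ≤ 2 ^ e := one_le_pow₀ one_le_two
  rw [encLen]
  rw [hlog] at hceil ⊢
  push_cast at hceil ⊢
  linarith

theorem sum_two_pow_mul_le {L : ℝ} (hL : 0 ≤ L) (e : ℕ) :
    ∑ i ∈ Finset.range (e + 1), (2 : ℝ) ^ i * (L - i + 5) ≤ 2 ^ (e + 1) * (L - e + 6) := by
  induction e with
  | zero =>
    rw [Finset.sum_range_one]
    norm_num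
    linarith
  | succ e ih =>
    rw [Finset.sum_range_succ]
    refine (add_le_add_left ih _).trans (le_of_eq ?_)
    push_cast
    ring

theorem sum_encLen_two_pow_le (hr0 : 0 < r) (hr : r ≤ n) :
    ∑ i ∈ Finset.range (Nat.log 2 r + 1), (encLen n (2 ^ i) : ℝ) ≤
      14 * (r * Real.logb 2 ((n : ℝ) / r) + r) := by
  set ρ := Nat.log 2 r
  have hr0' : (0 : ℝ) < r := by exact_mod_cast hr0
  have hn : (1 : ℝ) ≤ n := by exact_mod_cast hr0.trans_le hr
  have pow_le : 2 ^ ρ ≤ r := Nat.pow_log_le_self 2 hr0.ne'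
  have log_le : Real.logb 2 r ≤ ρ + 1 := by
    rw [Real.logb_le_iff_le_rpow one_lt_two hr0']
    exact_mod_cast (Nat.lt_pow_succ_log_self one_lt_two r).le
  have log_div : Real.logb 2 ((n : ℝ) / r) = Real.logb 2 n - Real.logb 2 r :=
    Real.logb_div (by positivity) hr0'.ne'
  have nonneg := mul_logb_div_nonneg hr
  have log_nonneg : 0 ≤ Real.logb 2 ((n : ℝ) / r) := nonneg_of_mul_nonneg_right nonneg hr0'
  calc ∑ i ∈ Finset.range (ρ + 1), (encLen n (2 ^ i) : ℝ)
      ≤ ∑ i ∈ Finset.range (ρ + 1), (2 : ℝ) ^ i * (Real.logb 2 n - i + 5) := by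
        refine Finset.sum_le_sum fun i hi => encLen_two_pow_le (le_trans ?_ (pow_le.trans hr))
        exact Nat.pow_le_pow_right two_pos (Finset.mem_range_succ_iff.1 hi)
    _ ≤ 2 ^ (ρ + 1) * (Real.logb 2 n - ρ + 6) :=
        sum_two_pow_mul_le (Real.logb_nonneg one_lt_two hn) ρ
    _ ≤ 2 ^ (ρ + 1) * (Real.logb 2 ((n : ℝ) / r) + 7) :=
        mul_le_mul_of_nonneg_left (by linarith) (by positivity)
    _ ≤ 2 * r * (Real.logb 2 ((n : ℝ) / r) + 7) := by
        rw [pow_succ']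
        gcongr
        exact_mod_cast pow_le
    _ ≤ 14 * (r * Real.logb 2 ((n : ℝ) / r) + r) := by linarith

theorem effEncLen_le (hr : r ≤ n) :
    (effEncLen n r : ℝ) ≤ 14 * (r * Real.logb 2 ((n : ℝ) / r) + r) := by
  rcases Nat.eq_zero_or_pos r with rfl | hr0
  · simp [effEncLen, blockSizes]
  have eq_sum : effEncLen n r = ∑ i ∈ r.bitIndices.toFinset, encLen n (2 ^ i) := by
    rw [effEncLen_eq_blocksLen, blocksLen, List.map_reverse, List.sum_reverse,
      List.sum_toFinset _ Nat.bitIndices_nodup]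
  have subset : r.bitIndices.toFinset ⊆ Finset.range (Nat.log 2 r + 1) := fun i hi =>
    Finset.mem_range_succ_iff.2 <| Nat.le_log_of_pow_le one_lt_two <|
      Nat.two_pow_le_of_mem_bitIndices (List.mem_toFinset.1 hi)
  rw [eq_sum, Nat.cast_sum]
  exact (Finset.sum_le_sum_of_subset_of_nonneg subset fun _ _ _ => Nat.cast_nonneg _).trans
    (sum_encLen_two_pow_le hr0 hr)

theorem blockAncillas_eq (n w e : ℕ) :
    blockAncillas n w e = 31 * (2 * w + 1) + 4 * ∑ i ∈ Finset.range e, encLen n (2 ^ i) := by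
  induction e with
  | zero => rw [blockAncillas, Finset.sum_range_zero, mul_zero, add_zero]
  | succ e ih =>
    rw [blockAncillas, ih, Finset.sum_range_succ]
    ring

theorem blockAncillas_le (w : ℕ) {e : ℕ} (he : 2 ^ e ≤ r) (hr : r ≤ n) :
    (blockAncillas n w e : ℝ) ≤
      31 * (2 * w + 1) + 56 * (r * Real.logb 2 ((n : ℝ) / r) + r) := by
  have hle : e ≤ Nat.log 2 r + 1 := (Nat.le_log_of_pow_le one_lt_two he).trans (Nat.le_succ _)
  have hsum := (Finset.sum_le_sum_of_subset_of_nonneg (Finset.range_mono hle)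
    fun i _ _ => Nat.cast_nonneg (encLen n (2 ^ i))).trans
      (sum_encLen_two_pow_le ((Nat.two_pow_pos e).trans_le he) hr)
  rw [blockAncillas_eq]
  push_cast
  linarith

/-- The number of bits of the counters. -/
def wordLength (n : ℕ) : ℕ := 3 * (Nat.log 2 (7 * n + 2) + 1)

theorem lt_two_pow_wordLength (n : ℕ) : (7 * n + 2) ^ 3 < 2 ^ wordLength n := by
  rw [wordLength, mul_comm 3, pow_mul]
  exact Nat.pow_lt_pow_left (Nat.lt_pow_succ_log_self one_lt_two _) three_ne_zero

theorem two_pow_wordLength_le (hn : 0 < n) : 2 ^ wordLength n ≤ (18 * n) ^ 3 := by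
  have hpow : 2 ^ Nat.log 2 (7 * n + 2) ≤ 7 * n + 2 := Nat.pow_log_le_self 2 (by omega)
  rw [wordLength, mul_comm 3, pow_mul]
  gcongr
  omega

theorem wordLength_le (hn : 0 < n) : (wordLength n : ℝ) ≤ 15 + 3 * Real.logb 2 n := by
  have hn' : (n : ℝ) ≠ 0 := by exact_mod_cast hn.ne'
  have hpow : (2 : ℝ) ^ wordLength n ≤ (2 ^ 5 * n) ^ 3 := by
    have := (two_pow_wordLength_le hn).trans
      (Nat.pow_le_pow_left (Nat.mul_le_mul_right n (by decide : 18 ≤ 2 ^ 5)) 3)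
    exact_mod_cast this
  calc (wordLength n : ℝ) = Real.logb 2 (2 ^ wordLength n) := by
        rw [Real.logb_pow, Real.logb_self_eq_one one_lt_two, mul_one]
    _ ≤ Real.logb 2 ((2 ^ 5 * n) ^ 3) := Real.logb_le_logb_of_le one_lt_two (by positivity) hpow
    _ = 15 + 3 * Real.logb 2 n := by
        rw [Real.logb_pow, Real.logb_mul (by norm_num) hn', Real.logb_pow,
          Real.logb_self_eq_one one_lt_two]
        push_cast
        ring

theorem exists_blockAncillas_le (hr : r ≤ n) :
    ∃ a : ℕ, (a : ℝ) ≤ 1400 * (r * Real.logb 2 ((n : ℝ) / r) + r + Real.logb 2 n) ∧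
      ∀ e, 2 ^ e ≤ r → blockAncillas n (wordLength n) e ≤ a := by
  have log_nonneg : 0 ≤ Real.logb 2 (n : ℝ) :=
    div_nonneg (Real.log_natCast_nonneg n) (Real.log_nonneg one_le_two)
  have bound_nonneg := mul_logb_div_nonneg hr
  refine ⟨⌊1400 * (r * Real.logb 2 ((n : ℝ) / r) + r + Real.logb 2 n)⌋₊,
    Nat.floor_le (by positivity), fun e he => Nat.le_floor ?_⟩
  have hr0 : 0 < r := (Nat.two_pow_pos e).trans_le he
  have hr1 : (1 : ℝ) ≤ r := by exact_mod_cast hr0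
  have := wordLength_le (hr0.trans_le hr)
  refine (blockAncillas_le _ he hr).trans ?_
  linarith

theorem blockGates_le {e : ℕ} (he : 2 ^ e ≤ n) :
    8 ^ e * 2 ^ (249 * wordLength n) ≤ n ^ 3 * (18 * n) ^ (3 * 249) := by
  have hn : 0 < n := (Nat.two_pow_pos e).trans_le he
  calc 8 ^ e * 2 ^ (249 * wordLength n) = (2 ^ e) ^ 3 * (2 ^ wordLength n) ^ 249 := by
        rw [show 8 = 2 ^ 3 from rfl, pow_right_comm, ← pow_mul 2 _ 249, mul_comm 249]
    _ ≤ n ^ 3 * ((18 * n) ^ 3) ^ 249 :=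
        Nat.mul_le_mul (Nat.pow_le_pow_left he 3)
          (Nat.pow_le_pow_left (two_pow_wordLength_le hn) 249)
    _ = n ^ 3 * (18 * n) ^ (3 * 249) := by rw [← pow_mul]

end Bounds

end QBall

theorem mainTheorem3 :
    ∃ (K : ℝ) (A d : ℕ), ∀ (n r : ℕ) (F : QBall.Formula n), r ≤ n →
      (2 * QBall.effEncLen n r : ℝ) ≤ K * (r * Real.logb 2 ((n : ℝ) / r) + r) ∧
      ∃ (f : Equiv.Perm (Fin (2 * r + 2 * QBall.effEncLen n r) → Bool)) (l g : ℕ),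
        (l : ℝ) ≤ K * (r * Real.logb 2 ((n : ℝ) / r) + r + Real.logb 2 n) ∧
        g ≤ A * n ^ d ∧
        QBall.ImplementableReversibly f l g ∧
        ∀ s : Fin r → Fin 3,
          f (Fin.append (QBall.tritReg r (List.ofFn s))
              (QBall.zeros (2 * QBall.effEncLen n r))) =
            Fin.append (QBall.tritReg r (List.ofFn s))
              (QBall.tritReg (QBall.effEncLen n r) (QBall.effEnc F (List.ofFn s))) := by
  refine ⟨1400, 18 ^ (3 * 249), 4 + 3 * 249, fun n r F hr => ?_⟩
  obtain ⟨a, ha, hblocks⟩ := QBall.exists_blockAncillas_le hr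
  obtain ⟨f, hf, hspec⟩ := QBall.exists_perm_effEnc (QBall.lt_two_pow_wordLength n) F hr hblocks
    fun e he => QBall.blockGates_le (he.trans hr)
  refine ⟨?_, f, a, _, ha, ?_, hf, hspec⟩
  · have := QBall.effEncLen_le hr
    have := QBall.mul_logb_div_nonneg hr
    have := Nat.cast_nonneg (α := ℝ) r
    linarith
  · have collect (k : ℕ) : n * (n ^ 3 * (18 * n) ^ k) = 18 ^ k * n ^ (4 + k) := by ring
    exact (Nat.mul_le_mul_right _ hr).trans_eq (collect _)
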